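/- Let $n \ge 2$, and let $\mathcal K^n$ be the set of nonempty compact convex subsets of $\mathbb R^n$, with the Hausdorff metric. For $K \in \mathcal K^n$ let $W_0(K),\dots,W_n(K)$ be the quermassintegrals of $K$, that is, the coefficients in the Steiner formula $$\mathrm{vol}(K+\rho B_n)=\sum_{i=0}^n \rho^i\binom{n}{i}W_i(K)\qquad(\rho\ge 0),$$ where $B_n$ is the closed Euclidean unit ball. An operator $\Diamond:\mathcal K^n\to\mathcal K^n$ is $GL(n)$-covariant if $\Diamond(gK)=g\,\Diamond K$ for all $g\in GL(n)$ and $K\in\mathcal K^n$, and it satisfies a Rogers-Shephard type inequality for $W_l$ if there is a constant $C>0$ such that $W_l(\Diamond K)\le C\,W_l(K)$ for all $K\in\mathcal K^n$. An operator $\Diamond:\mathcal K^n\to\mathcal K^n$ is continuous, $GL(n)$-covariant and satisfies a Rogers-Shephard type inequality for $W_l$ for some $l\in\{0,1,\dots,n-1\}$ if and only if there are $a,b\ge 0$ such that $\Diamond K=aK+b(-K)$ for all $K\in\mathcal K^n$. Moreover, in that case $\Diamond$ satisfies a Rogers-Shephard type inequality for $W_l$ for every $l\in\{0,1,\dots,n-1\}$.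 -/

import Mathlib

open scoped Pointwise

/-- `𝒦ⁿ`: nonempty compact convex subsets of Euclidean `ℝⁿ`, with the Hausdorff metric. -/
abbrev Kn (n : ℕ) : Type := ConvexBody (EuclideanSpace ℝ (Fin n))

/-- The image `g K` of a convex body under an invertible linear map `g`. -/
def Kn.image {n : ℕ} (g : EuclideanSpace ℝ (Fin n) ≃L[ℝ] EuclideanSpace ℝ (Fin n)) (K : Kn n) :
    Kn n where
  carrier := g '' (K : Set (EuclideanSpace ℝ (Fin n)))
  convex' := K.convex.is_linear_image g.toLinearEquiv.toLinearMap.isLinear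
  isCompact' := K.isCompact.image g.continuous
  nonempty' := K.nonempty.image g

/-- `◇ (g K) = g (◇ K)` for all `g ∈ GL(n)` and all `K ∈ 𝒦ⁿ`. -/
def GLCovariant {n : ℕ} (D : Kn n → Kn n) : Prop :=
  ∀ (g : EuclideanSpace ℝ (Fin n) ≃L[ℝ] EuclideanSpace ℝ (Fin n)) (K : Kn n),
    D (Kn.image g K) = Kn.image g (D K)

/-- `vol (K + ρ Bₙ)`, with `Bₙ` the closed Euclidean unit ball. -/
noncomputable def parallelVolume {n : ℕ} (K : Kn n) (ρ : ℝ) : ℝ :=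
  MeasureTheory.volume.real ((K : Set (EuclideanSpace ℝ (Fin n))) +
    ρ • Metric.closedBall (0 : EuclideanSpace ℝ (Fin n)) 1)

/-- The Steiner polynomial of `K`. By the Steiner formula `ρ ↦ vol (K + ρ Bₙ)`, `ρ ≥ 0`, is a
polynomial function of degree at most `n`; it is therefore given by the only polynomial of degree
at most `n` with the same values at `ρ = 0, 1, …, n`. -/
noncomputable def steinerPolynomial {n : ℕ} (K : Kn n) : Polynomial ℝ :=
  Lagrange.interpolate (Finset.range (n + 1)) (fun i : ℕ => (i : ℝ))
    (fun i : ℕ => parallelVolume K (i : ℝ))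

/-- The quermassintegral `W_l(K)`: the coefficient of `ρ ^ l` in the Steiner polynomial of `K` is
`n.choose l * W_l(K)`. -/
noncomputable def quermassintegral {n : ℕ} (l : ℕ) (K : Kn n) : ℝ :=
  (steinerPolynomial K).coeff l / (n.choose l : ℝ)

/-- The numbers `W_l(K)` are the ones in the Steiner formula
`vol (K + ρ Bₙ) = ∑ i ≤ n, ρ ^ i * n.choose i * W_i(K)`, `ρ ≥ 0`. -/
theorem quermassintegral_eq_of_steiner {n : ℕ} (K : Kn n) (w : ℕ → ℝ)
    (hw : ∀ ρ : ℝ, 0 ≤ ρ →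
      parallelVolume K ρ = ∑ i ∈ Finset.range (n + 1), ρ ^ i * (n.choose i : ℝ) * w i)
    (l : ℕ) (hl : l ≤ n) : quermassintegral l K = w l := by
  have hp : (∑ i ∈ Finset.range (n + 1), Polynomial.monomial i ((n.choose i : ℝ) * w i)) =
      steinerPolynomial K := by
    refine Lagrange.eq_interpolate_of_eval_eq _ (fun a _ b _ h => by exact_mod_cast h) ?_ ?_
    · rw [Finset.card_range, Polynomial.degree_lt_iff_coeff_zero]
      intro m hm
      rw [Polynomial.finsetSum_coeff]
      refine Finset.sum_eq_zero fun i hi => ?_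
      rw [Polynomial.coeff_monomial, if_neg]
      have := Finset.mem_range.1 hi
      omega
    · intro i _
      rw [hw _ (Nat.cast_nonneg i), Polynomial.eval_finsetSum]
      refine Finset.sum_congr rfl fun j _ => ?_
      rw [Polynomial.eval_monomial]
      ring
  have hc : (n.choose l : ℝ) ≠ 0 := by exact_mod_cast (Nat.choose_pos hl).ne'
  rw [quermassintegral, ← hp, Polynomial.finsetSum_coeff, Finset.sum_eq_single l]
  · rw [Polynomial.coeff_monomial, if_pos rfl]
    field_simp
  · intro b _ hb
    rw [Polynomial.coeff_monomial, if_neg hb]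
  · intro h
    exact absurd (Finset.mem_range.2 (by omega)) h

/-- `◇` satisfies a Rogers-Shephard type inequality for the functional `φ` on `𝒦ⁿ`. -/
def RogersShephardType {n : ℕ} (φ : Kn n → ℝ) (D : Kn n → Kn n) : Prop :=
  ∃ C : ℝ, 0 < C ∧ ∀ K : Kn n, φ (D K) ≤ C * φ K

/-!
The two directions use different ideas.

**Quermassintegrals.** The only geometric input is that `t ↦ vol (K + t [-v, v])` is affine on
`t ≥ 0`: translates of `K + s [-v, v]` and `K + t [-v, v]` cover `K + (s + t) [-v, v]` and overlap
in a translate of `K` (`measureReal_add_smul_symSeg_add`). For a monotone functional `φ` with this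
property (`SegmentAffine`) the increment `φ (K + [-v, v]) - φ K` is the limit of
`φ (K + t [-v, v]) / t` and therefore monotone in `K` again. Hence `φ (K + ρ Z)`, for a zonotope
`Z`, is a polynomial in `ρ` whose coefficients are monotone in `K` (`SegmentAffine.expansion`). The
ball is a limit of zonotopes, as the average of `|⟨·, v⟩|` over the ball is a multiple of the norm
(`exists_zonotope_near_closedBall`), so the Steiner formula and the monotonicity of the `W_l` follow
in the limit (`steiner_formula`). A segment-affine functional that is homogeneous of degree `d` is
zero on sums of fewer than `d` segments, so that `W_l` vanishes on bodies of dimension less than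
`n - l`.

**Sufficiency.** By Helly's theorem `-K` has a translate inside `n K`, so `a K + b (-K)` lies in a
translate of `(a + b n + 1) K`. Monotonicity and homogeneity of `W_l` give the inequality.

**Necessity.** By continuity the operator `D` commutes with all linear maps, also the singular ones.
Projecting to lines shows that the value at `u` of the support function of `D K` is `F s t`, where
`[s, t]` is the range of `⟨u, ·⟩` on `K` and `F` is the `profile` of `D`. Applying `D` to segments
and triangles in a plane shows that `F` is sublinear and yields
`F 1 1 + F (-1) (-1) ≤ 8 * F (-1) 1`. If the left hand side is zero, that is, if `D` maps points to
points, then `F` is additive along the diagonal, hence linear on `s ≤ t`, and `D K = a K + b (-K)`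
(`exists_eq_smul_add_smul_neg`). If it is positive, then `D K` has positive width in every direction
`u` for which `⟨u, ·⟩` does not vanish on `K`. So `D` maps a cube of dimension `n - l - 1` in an
affine subspace that avoids the origin, where `W_l` is zero, to a body of dimension `n - l`, where
`W_l` is not zero, which contradicts the inequality (`profile_one_one_add_nonpos`).
-/

open scoped Pointwise
open MeasureTheory Filter Topology

/-! ### Segment-affine functionals and their expansions along zonotopes -/

section SegmentAffine

variable {V : Type*} [NormedAddCommGroup V] [NormedSpace ℝ V]

/-- The symmetric segment `[-v, v]` as a convex body. -/
def symSeg (v : V) : ConvexBody V where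
  carrier := (fun r : ℝ => r • v) '' Set.Icc (-1) 1
  convex' := (convex_Icc (-1 : ℝ) 1).is_linear_image
    (LinearMap.toSpanSingleton ℝ V v).isLinear
  isCompact' := isCompact_Icc.image (by fun_prop)
  nonempty' := (Set.nonempty_Icc.2 (by norm_num)).image _

/-- The zonotope `∑ [-v, v]`, summed over the entries `v` of a list. -/
noncomputable def zonotope (vs : List V) : ConvexBody V := (vs.map symSeg).sum

@[simp] theorem zonotope_nil : zonotope ([] : List V) = 0 := rfl

@[simp] theorem zonotope_cons (v : V) (vs : List V) :
    zonotope (v :: vs) = symSeg v + zonotope vs := by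
  simp [zonotope]

theorem mem_smul_symSeg {v x : V} {t : ℝ} (ht : 0 ≤ t) :
    x ∈ ((t • symSeg v : ConvexBody V) : Set V) ↔ ∃ r ∈ Set.Icc (-t) t, r • v = x := by
  rw [ConvexBody.coe_smul, Set.mem_smul_set]
  constructor
  · rintro ⟨_, ⟨r, hr, rfl⟩, rfl⟩
    refine ⟨t * r, ⟨?_, ?_⟩, by simp [mul_smul]⟩ <;> nlinarith [hr.1, hr.2]
  · rintro ⟨r, hr, rfl⟩
    rcases ht.eq_or_lt with rfl | ht
    · have : r = 0 := by simpa using hr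
      exact ⟨0, ⟨0, by simp, by simp⟩, by simp [this]⟩
    · refine ⟨(r / t) • v, ⟨r / t, ⟨?_, ?_⟩, rfl⟩, ?_⟩
      · rw [le_div_iff₀ ht]; linarith [hr.1]
      · rw [div_le_iff₀ ht]; linarith [hr.2]
      · rw [smul_smul, mul_div_cancel₀ _ ht.ne']

/-- The functionals on convex bodies that are monotone under inclusion and affine under the
addition of dilates of a segment. Volume is one of them, and so are all the coefficients in the
expansions of such a functional along zonotopes. -/
structure SegmentAffine (φ : ConvexBody V → ℝ) : Prop where
  mono : ∀ {K L : ConvexBody V}, (K : Set V) ⊆ L → φ K ≤ φ L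
  affine : ∀ (K : ConvexBody V) (v : V) {t : ℝ}, 0 ≤ t →
    φ (K + t • symSeg v) = φ K + t * (φ (K + symSeg v) - φ K)

namespace SegmentAffine

theorem zero : SegmentAffine (0 : ConvexBody V → ℝ) := ⟨by simp, by simp⟩

theorem add {φ ψ : ConvexBody V → ℝ} (hφ : SegmentAffine φ) (hψ : SegmentAffine ψ) :
    SegmentAffine (φ + ψ) where
  mono h := add_le_add (hφ.mono h) (hψ.mono h)
  affine K v t ht := by
    simp only [Pi.add_apply, hφ.affine K v ht, hψ.affine K v ht]; ring

/-- Pointwise limits of segment-affine functionals are segment-affine. -/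
theorem of_tendsto {φ : ℕ → ConvexBody V → ℝ} {ψ : ConvexBody V → ℝ}
    (hφ : ∀ m, SegmentAffine (φ m)) (h : ∀ K, Tendsto (fun m => φ m K) atTop (𝓝 (ψ K))) :
    SegmentAffine ψ where
  mono hKL := le_of_tendsto_of_tendsto' (h _) (h _) fun m => (hφ m).mono hKL
  affine K v t ht := by
    refine tendsto_nhds_unique (h _) ?_
    simp only [fun m => (hφ m).affine K v ht]
    exact (h K).add (((h _).sub (h K)).const_mul t)

/-- The increments `φ (K + [-v, v]) - φ K` of a segment-affine functional are monotone in `K`,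
because they are the limits of `φ (K + t [-v, v]) / t` as `t → ∞`. -/
theorem diff {φ : ConvexBody V → ℝ} (hφ : SegmentAffine φ) (v : V) :
    SegmentAffine (fun K => φ (K + symSeg v) - φ K) where
  mono {K L} hKL := by
    have lim : ∀ K : ConvexBody V, Tendsto (fun t : ℝ => φ (K + t • symSeg v) / t) atTop
        (𝓝 (φ (K + symSeg v) - φ K)) := by
      intro K
      have h0 : Tendsto (fun t : ℝ => φ K / t + (φ (K + symSeg v) - φ K)) atTop
          (𝓝 (0 + (φ (K + symSeg v) - φ K))) :=
        (tendsto_const_nhds.div_atTop tendsto_id).add tendsto_const_nhds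
      rw [zero_add] at h0
      refine h0.congr' ?_
      filter_upwards [eventually_gt_atTop (0 : ℝ)] with t ht
      rw [hφ.affine K v ht.le]
      field_simp
    refine le_of_tendsto_of_tendsto (lim K) (lim L) ?_
    filter_upwards [eventually_gt_atTop (0 : ℝ)] with t ht
    refine div_le_div_of_nonneg_right (hφ.mono ?_) ht.le
    rw [ConvexBody.coe_add, ConvexBody.coe_add]
    exact Set.add_subset_add_right hKL
  affine K w t ht := by
    have h1 := hφ.affine K w ht
    have h2 := hφ.affine (K + symSeg v) w ht
    rw [add_right_comm K (symSeg v) (t • symSeg w), add_right_comm K (symSeg v) (symSeg w)] at h2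
    simp only [h1, h2]
    ring

/-- A segment-affine functional is a polynomial along the dilates of a zonotope, with
segment-affine coefficients. -/
theorem expansion {φ : ConvexBody V → ℝ} (hφ : SegmentAffine φ) (vs : List V) :
    ∃ a : ℕ → ConvexBody V → ℝ, (∀ j, SegmentAffine (a j)) ∧
      ∀ (K : ConvexBody V) (ρ : ℝ), 0 ≤ ρ →
        φ (K + ρ • zonotope vs) = ∑ j ∈ Finset.range (vs.length + 1), ρ ^ j * a j K := by
  induction vs with
  | nil =>
    exact ⟨fun _ => φ, fun _ => hφ, by simp⟩
  | cons v vs ih =>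
    obtain ⟨a, ha, hφa⟩ := ih
    let a' : ℕ → ConvexBody V → ℝ := fun j => if j ≤ vs.length then a j else 0
    have ha' : ∀ j, SegmentAffine (a' j) := by
      intro j
      by_cases h : j ≤ vs.length
      · simpa [a', h] using ha j
      · simpa [a', h] using zero
    have hφa' : ∀ (K : ConvexBody V) (ρ : ℝ), 0 ≤ ρ →
        φ (K + ρ • zonotope vs) = ∑ j ∈ Finset.range (vs.length + 1), ρ ^ j * a' j K := by
      intro K ρ hρ
      rw [hφa K ρ hρ]
      refine Finset.sum_congr rfl fun j hj => ?_
      rw [Finset.mem_range] at hj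
      simp [a', Nat.lt_succ_iff.1 hj]
    refine ⟨fun j => Nat.casesOn j (a' 0)
      (fun i => a' (i + 1) + fun K => a' i (K + symSeg v) - a' i K), ?_, ?_⟩
    · rintro (_ | j)
      · exact ha' 0
      · exact (ha' (j + 1)).add ((ha' j).diff v)
    · intro K ρ hρ
      have e : K + ρ • zonotope (v :: vs) = (K + ρ • zonotope vs) + ρ • symSeg v := by
        rw [zonotope_cons, smul_add, add_assoc, add_comm (ρ • symSeg v)]
      have e' : K + ρ • zonotope vs + symSeg v = (K + symSeg v) + ρ • zonotope vs := by
        rw [add_right_comm]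
      rw [e, hφ.affine _ _ hρ, e', hφa' _ _ hρ, hφa' _ _ hρ, List.length_cons,
        Finset.sum_range_succ' _ (vs.length + 1)]
      simp only [Pi.add_apply, mul_add, Finset.sum_add_distrib]
      have h1 : ∑ j ∈ Finset.range (vs.length + 1), ρ ^ j * a' j K =
          ∑ j ∈ Finset.range (vs.length + 1), ρ ^ (j + 1) * a' (j + 1) K + ρ ^ 0 * a' 0 K := by
        rw [← Finset.sum_range_succ' (fun j => ρ ^ j * a' j K) (vs.length + 1),
          Finset.sum_range_succ _ (vs.length + 1)]
        simp [a']
      have h2 : ρ * (∑ j ∈ Finset.range (vs.length + 1), ρ ^ j * a' j (K + symSeg v) -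
          ∑ j ∈ Finset.range (vs.length + 1), ρ ^ j * a' j K) =
          ∑ j ∈ Finset.range (vs.length + 1), ρ ^ (j + 1) * (a' j (K + symSeg v) - a' j K) := by
        rw [← Finset.sum_sub_distrib, Finset.mul_sum]
        refine Finset.sum_congr rfl fun j _ => ?_
        ring
      rw [h2, h1]
      change _ = _ + ρ ^ 0 * a' 0 K
      ring

end SegmentAffine

/-- Coefficient comparison for polynomials that agree on the positive reals. -/
theorem coeff_unique {m : ℕ} {a b : ℕ → ℝ}
    (h : ∀ ρ : ℝ, 0 < ρ → ∑ j ∈ Finset.range m, ρ ^ j * a j = ∑ j ∈ Finset.range m, ρ ^ j * b j)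
    {j : ℕ} (hj : j < m) : a j = b j := by
  have key : ∀ c : ℕ → ℝ, ∀ i < m,
      (∑ j ∈ Finset.range m, Polynomial.monomial j (c j)).coeff i = c i := by
    intro c i hi
    rw [Polynomial.finsetSum_coeff, Finset.sum_eq_single i]
    · simp
    · intro b _ hb; simp [Polynomial.coeff_monomial, hb]
    · intro h; exact absurd (Finset.mem_range.2 hi) h
  have hp : (∑ j ∈ Finset.range m, Polynomial.monomial j (a j)) =
      ∑ j ∈ Finset.range m, Polynomial.monomial j (b j) := by
    refine Polynomial.eq_of_infinite_eval_eq _ _ ((Set.Ioi_infinite (0 : ℝ)).mono ?_)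
    intro ρ hρ
    simp only [Set.mem_ofPred_eq, Polynomial.eval_finsetSum, Polynomial.eval_monomial]
    simpa only [mul_comm] using h ρ hρ
  rw [← key a j hj, hp, key b j hj]

namespace SegmentAffine

/-- A segment-affine functional that is homogeneous of degree `d` vanishes on the sums of fewer
than `d` segments. -/
theorem zonotope_eq_zero {φ : ConvexBody V → ℝ} (hφ : SegmentAffine φ) {d : ℕ}
    (hd : ∀ (K : ConvexBody V) {t : ℝ}, 0 < t → φ (t • K) = t ^ d * φ K) {vs : List V}
    (hvs : vs.length < d) : φ (zonotope vs) = 0 := by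
  obtain ⟨a, -, hφa⟩ := hφ.expansion vs
  have h := coeff_unique (m := d + 1) (a := fun j => if j = d then φ (zonotope vs) else 0)
    (b := fun j => if j < vs.length + 1 then a j 0 else 0) ?_ (Nat.lt_succ_self d)
  · simpa [show ¬ d ≤ vs.length by omega] using h
  · intro ρ hρ
    have h1 := hφa 0 ρ hρ.le
    rw [zero_add, hd _ hρ] at h1
    simp only [mul_ite, mul_zero, Finset.sum_ite_eq', Finset.mem_range, Nat.lt_succ_self, if_true]
    rw [h1, ← Finset.sum_filter]
    refine Finset.sum_congr ?_ fun _ _ => rfl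
    ext j
    simp only [Finset.mem_range, Finset.mem_filter]
    omega

end SegmentAffine

end SegmentAffine

/-! ### Volume is segment-affine -/

/-- An additive nonnegative function on `[0, ∞)` is linear. -/
theorem eq_mul_of_additive_of_nonneg {g : ℝ → ℝ}
    (hadd : ∀ s t, 0 ≤ s → 0 ≤ t → g (s + t) = g s + g t) (hg : ∀ t, 0 ≤ t → 0 ≤ g t)
    {t : ℝ} (ht : 0 ≤ t) : g t = t * g 1 := by
  have hmono : ∀ s t, 0 ≤ s → s ≤ t → g s ≤ g t := by
    intro s t hs hst
    have := hadd s (t - s) hs (by linarith)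
    rw [add_sub_cancel] at this
    linarith [hg (t - s) (by linarith)]
  have h0 : g 0 = 0 := by
    have := hadd 0 0 le_rfl le_rfl
    rw [add_zero] at this
    linarith
  have hnat : ∀ (m : ℕ) (s : ℝ), 0 ≤ s → g (m * s) = m * g s := by
    intro m s hs
    induction m with
    | zero => simp [h0]
    | succ m ih =>
      push_cast
      rw [add_mul, one_mul, hadd _ _ (by positivity) hs, ih]
      ring
  have h1 := hg 1 zero_le_one
  have bound : ∀ m : ℕ, |g t - t * g 1| * m ≤ g 1 := by
    intro m
    have hf := Nat.floor_le (show 0 ≤ m * t by positivity)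
    have hf' := (Nat.lt_floor_add_one (m * t)).le
    have hl := hmono _ _ (by positivity) hf
    have hu := hmono _ _ (by positivity) hf'
    have e1 := hnat ⌊m * t⌋₊ 1 zero_le_one
    have e2 := hnat (⌊m * t⌋₊ + 1) 1 zero_le_one
    push_cast at e2
    rw [mul_one] at e1 e2
    rw [e1, hnat m t ht] at hl
    rw [e2, hnat m t ht] at hu
    have hm : |g t - t * g 1| * m = |m * g t - m * t * g 1| := by
      rw [← abs_of_nonneg (Nat.cast_nonneg (α := ℝ) m), ← abs_mul,
        abs_of_nonneg (Nat.cast_nonneg (α := ℝ) m)]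
      congr 1; ring
    rw [hm, abs_le]
    constructor <;> nlinarith
  by_contra hne
  have hpos : 0 < |g t - t * g 1| := abs_pos.2 (sub_ne_zero.2 hne)
  obtain ⟨m, hm⟩ := exists_nat_gt (g 1 / |g t - t * g 1|)
  rw [div_lt_iff₀ hpos] at hm
  linarith [bound m]

theorem measureReal_vadd_eq {V : Type*} [AddGroup V] [MeasurableSpace V] [MeasurableAdd V]
    (μ : Measure V) [μ.IsAddLeftInvariant] (x : V) (s : Set V) : μ.real (x +ᵥ s) = μ.real s := by
  simp [Measure.real, measure_vadd]

section

variable {V : Type*} [NormedAddCommGroup V] [NormedSpace ℝ V]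

theorem mem_add_smul_symSeg {K : ConvexBody V} {v x : V} {t : ℝ} (ht : 0 ≤ t) :
    x ∈ ((K + t • symSeg v : ConvexBody V) : Set V) ↔ ∃ r, |r| ≤ t ∧ x - r • v ∈ K := by
  rw [ConvexBody.coe_add, Set.mem_add]
  constructor
  · rintro ⟨k, hk, y, hy, rfl⟩
    obtain ⟨r, hr, rfl⟩ := (mem_smul_symSeg ht).1 hy
    exact ⟨r, abs_le.2 hr, by simpa using hk⟩
  · rintro ⟨r, hr, hx⟩
    exact ⟨_, hx, r • v, (mem_smul_symSeg ht).2 ⟨r, abs_le.1 hr, rfl⟩, by simp⟩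

theorem mem_vadd_add_smul_symSeg {K : ConvexBody V} {v x : V} {t c : ℝ} (ht : 0 ≤ t) :
    x ∈ c • v +ᵥ ((K + t • symSeg v : ConvexBody V) : Set V) ↔
      ∃ r, |r - c| ≤ t ∧ x - r • v ∈ K := by
  rw [Set.mem_vadd_set_iff_neg_vadd_mem, mem_add_smul_symSeg ht, vadd_eq_add]
  constructor
  · rintro ⟨r, hr, h⟩
    refine ⟨r + c, by simpa using hr, ?_⟩
    convert h using 1
    module
  · rintro ⟨r, hr, h⟩
    refine ⟨r - c, hr, ?_⟩
    convert h using 1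
    module

end

section Volume

variable {V : Type*} [NormedAddCommGroup V] [NormedSpace ℝ V] [MeasurableSpace V] [BorelSpace V]
  (μ : Measure V) [μ.IsAddHaarMeasure]

/-- Suitable translates of `K + s [-v, v]` and `K + t [-v, v]` cover `K + (s + t) [-v, v]`, and by
convexity of `K` they overlap in a translate of `K`. -/
theorem measureReal_add_smul_symSeg_add (K : ConvexBody V) (v : V) {s t : ℝ} (hs : 0 ≤ s)
    (ht : 0 ≤ t) :
    μ.real ((K + (s + t) • symSeg v : ConvexBody V) : Set V) + μ.real (K : Set V) =
      μ.real ((K + s • symSeg v : ConvexBody V) : Set V) +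
        μ.real ((K + t • symSeg v : ConvexBody V) : Set V) := by
  set A : Set V := (-t) • v +ᵥ ((K + s • symSeg v : ConvexBody V) : Set V) with hA
  set B : Set V := s • v +ᵥ ((K + t • symSeg v : ConvexBody V) : Set V) with hB
  have hAc : IsCompact A := (K + s • symSeg v).isCompact.vadd _
  have hBc : IsCompact B := (K + t • symSeg v).isCompact.vadd _
  have hunion : A ∪ B = ((K + (s + t) • symSeg v : ConvexBody V) : Set V) := by
    ext x
    rw [Set.mem_union, hA, hB, mem_vadd_add_smul_symSeg hs, mem_vadd_add_smul_symSeg ht,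
      mem_add_smul_symSeg (add_nonneg hs ht)]
    constructor
    · rintro (⟨r, hr, h⟩ | ⟨r, hr, h⟩) <;>
      · refine ⟨r, ?_, h⟩
        rw [abs_le] at hr ⊢
        constructor <;> linarith [hr.1, hr.2]
    · rintro ⟨r, hr, h⟩
      rw [abs_le] at hr
      rcases le_total r (s - t) with h' | h'
      · exact Or.inl ⟨r, abs_le.2 ⟨by linarith, by linarith⟩, h⟩
      · exact Or.inr ⟨r, abs_le.2 ⟨by linarith, by linarith⟩, h⟩
  have hinter : A ∩ B = (s - t) • v +ᵥ (K : Set V) := by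
    ext x
    rw [Set.mem_inter_iff, hA, hB, mem_vadd_add_smul_symSeg hs, mem_vadd_add_smul_symSeg ht,
      Set.mem_vadd_set_iff_neg_vadd_mem, vadd_eq_add, neg_add_eq_sub]
    constructor
    · rintro ⟨⟨p, hp, h⟩, ⟨q, hq, h'⟩⟩
      rw [abs_le] at hp hq
      have hp' : p ≤ s - t := by linarith [hp.2]
      have hq' : s - t ≤ q := by linarith [hq.1]
      rcases (hp'.trans hq').eq_or_lt with rfl | hpq
      · rwa [← le_antisymm hp' hq']
      · have := K.convex h h' (a := (q - (s - t)) / (q - p)) (b := (s - t - p) / (q - p))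
          (div_nonneg (by linarith) (by linarith)) (div_nonneg (by linarith) (by linarith))
          (by rw [← add_div]; exact (div_eq_one_iff_eq (by linarith)).2 (by ring))
        convert this using 1
        have hne : q - p ≠ 0 := by linarith
        have e1 : (q - (s - t)) / (q - p) + (s - t - p) / (q - p) = 1 := by
          rw [← add_div]; exact (div_eq_one_iff_eq hne).2 (by ring)
        have e2 : (q - (s - t)) / (q - p) * p + (s - t - p) / (q - p) * q = s - t := by
          field_simp; ring
        rw [smul_sub, smul_sub, smul_smul, smul_smul, sub_add_sub_comm, ← add_smul, ← add_smul,
          e1, e2, one_smul]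
    · intro h
      exact ⟨⟨s - t, by simpa using (abs_of_nonneg hs).le, h⟩,
        ⟨s - t, by simpa [abs_of_nonneg] using (abs_of_nonneg ht).le, h⟩⟩
  have key := measureReal_union_add_inter (μ := μ) (s := A) hBc.measurableSet
    hAc.measure_lt_top.ne hBc.measure_lt_top.ne
  rwa [hunion, hinter, hA, hB, measureReal_vadd_eq, measureReal_vadd_eq, measureReal_vadd_eq]
    at key

/-- Volume is segment-affine. -/
theorem segmentAffine_measureReal :
    SegmentAffine (fun K : ConvexBody V => μ.real (K : Set V)) where
  mono {_ L} h := measureReal_mono h L.isCompact.measure_lt_top.ne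
  affine K v t ht := by
    have h := eq_mul_of_additive_of_nonneg
      (g := fun t => μ.real ((K + t • symSeg v : ConvexBody V) : Set V) - μ.real (K : Set V))
      (fun s t hs ht => by linarith [measureReal_add_smul_symSeg_add μ K v hs ht])
      (fun t ht => ?_) ht
    · simp only [one_smul] at h
      linarith
    · refine sub_nonneg.2 (measureReal_mono ?_ (K + t • symSeg v).isCompact.measure_lt_top.ne)
      intro x hx
      exact (mem_add_smul_symSeg ht).2 ⟨0, by simpa using ht, by simpa using hx⟩

variable [FiniteDimensional ℝ V]

theorem measureReal_smul_eq (K : ConvexBody V) {t : ℝ} (ht : 0 < t) :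
    μ.real ((t • K : ConvexBody V) : Set V) =
      t ^ Module.finrank ℝ V * μ.real (K : Set V) := by
  rw [ConvexBody.coe_smul, Measure.real, Measure.addHaar_smul, ENNReal.toReal_mul,
    ENNReal.toReal_ofReal (abs_nonneg _), abs_of_nonneg (by positivity)]
  rfl

/-- The Steiner formula for a zonotope in place of the ball. The coefficient of `ρ ^ j` is
homogeneous of degree `dim V - j` and monotone, and hence zero for `j > dim V`. -/
theorem exists_measureReal_add_smul_zonotope (vs : List V) :
    ∃ a : ℕ → ConvexBody V → ℝ, (∀ j, SegmentAffine (a j)) ∧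
      ∀ (K : ConvexBody V) (ρ : ℝ), 0 ≤ ρ →
        μ.real ((K + ρ • zonotope vs : ConvexBody V) : Set V) =
          ∑ j ∈ Finset.range (Module.finrank ℝ V + 1), ρ ^ j * a j K := by
  obtain ⟨a, ha, h⟩ := (segmentAffine_measureReal μ).expansion vs
  set n := Module.finrank ℝ V
  set m := vs.length + 1
  have hom : ∀ j < m, ∀ (K : ConvexBody V) (t : ℝ), 0 < t → a j (t • K) * t ^ j =
      t ^ n * a j K := by
    intro j hj K t ht
    refine coeff_unique (m := m) (a := fun j => a j (t • K) * t ^ j)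
      (b := fun j => t ^ n * a j K) (fun ρ hρ => ?_) hj
    have e : t • K + (t * ρ) • zonotope vs = t • (K + ρ • zonotope vs) := by
      rw [smul_add, smul_smul]
    have h1 := h (t • K) (t * ρ) (by positivity)
    rw [e, measureReal_smul_eq μ _ ht, h K ρ hρ.le, Finset.mul_sum] at h1
    calc _ = ∑ j ∈ Finset.range m, (t * ρ) ^ j * a j (t • K) :=
          Finset.sum_congr rfl fun j _ => by rw [mul_pow]; ring
      _ = _ := by
          rw [← h1]
          exact Finset.sum_congr rfl fun j _ => by ring
  have vanish0 : ∀ j < m, n < j → ∀ K : ConvexBody V, (0 : V) ∈ K → a j K = 0 := by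
    intro j hj hnj K hK
    have hz : a j 0 = 0 := by
      have h2 := hom j hj 0 2 two_pos
      rw [smul_zero] at h2
      have : (2 : ℝ) ^ n < 2 ^ j := pow_lt_pow_right₀ one_lt_two hnj
      by_contra hne
      rw [mul_comm] at h2
      exact this.ne' (mul_right_cancel₀ hne h2)
    have hnn : 0 ≤ a j K := by
      rw [← hz]
      refine (ha j).mono ?_
      rw [ConvexBody.coe_zero]
      simpa using hK
    have hle : a j K ≤ a j ((2 : ℝ) • K) := by
      refine (ha j).mono fun x hx => ?_
      rw [ConvexBody.coe_smul]
      exact K.convex.mem_smul_of_zero_mem hK hx one_le_two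
    have h2 := hom j hj K 2 two_pos
    have : (2 : ℝ) ^ n < 2 ^ j := pow_lt_pow_right₀ one_lt_two hnj
    nlinarith [pow_pos (two_pos (α := ℝ)) j]
  have vanish : ∀ j < m, n < j → ∀ K : ConvexBody V, a j K = 0 := by
    intro j hj hnj K
    -- the coefficients are translation invariant, so `K` may be assumed to contain `0`
    obtain ⟨x, hx⟩ := K.nonempty
    let T : ConvexBody V := ⟨{-x}, convex_singleton _, isCompact_singleton,
      Set.singleton_nonempty _⟩
    have hT : a j (T + K) = 0 :=
      vanish0 j hj hnj _ (Set.mem_add.2 ⟨-x, rfl, x, hx, by simp⟩)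
    rw [← hT]
    refine coeff_unique (m := m) (a := fun j => a j K) (b := fun j => a j (T + K))
      (fun ρ hρ => ?_) hj
    rw [← h K ρ hρ.le, ← h (T + K) ρ hρ.le, add_assoc, ConvexBody.coe_add T,
      ← measureReal_vadd_eq μ (-x)]
    congr 1
    rw [← Set.singleton_vadd]
    rfl
  refine ⟨fun j => if j < m then a j else 0, fun j => ?_, fun K ρ hρ => ?_⟩
  · by_cases hj : j < m
    · simpa [hj] using ha j
    · simpa [hj] using SegmentAffine.zero
  · rw [h K ρ hρ]
    have e1 : ∑ j ∈ Finset.range m, ρ ^ j * a j K =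
        ∑ j ∈ Finset.range (max m (n + 1)), ρ ^ j * (if j < m then a j else 0) K := by
      refine (Finset.sum_congr rfl fun j hj => ?_).trans
        (Finset.sum_subset (Finset.range_mono (le_max_left _ _)) fun j _ hj => ?_)
      · rw [if_pos (Finset.mem_range.1 hj)]
      · rw [if_neg (fun h => hj (Finset.mem_range.2 h))]; simp
    rw [e1]
    refine (Finset.sum_subset (Finset.range_mono (le_max_right _ _)) fun j _ hj => ?_).symm
    rw [Finset.mem_range, not_lt] at hj
    split_ifs with h'
    · rw [vanish j h' (by omega), mul_zero]
    · simp

end Volume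

/-! ### Balls are limits of zonotopes -/

section Zonoid

variable {V : Type*} [NormedAddCommGroup V] [InnerProductSpace ℝ V]

/-- The support function of the zonotope `∑ [-v, v]`, see `inner_le_zonotopeSupport` and
`exists_inner_eq_zonotopeSupport`. -/
noncomputable def zonotopeSupport (vs : List V) (u : V) : ℝ :=
  (vs.map fun v => |inner ℝ u v|).sum

theorem zonotopeSupport_smul (vs : List V) (r : ℝ) (u : V) :
    zonotopeSupport vs (r • u) = |r| * zonotopeSupport vs u := by
  simp only [zonotopeSupport, real_inner_smul_left, abs_mul, List.sum_map_mul_left]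

theorem inner_le_zonotopeSupport {vs : List V} (u : V) {x : V} (hx : x ∈ zonotope vs) :
    inner ℝ u x ≤ zonotopeSupport vs u := by
  induction vs generalizing x with
  | nil =>
    have : x = 0 := hx
    simp [this, zonotopeSupport]
  | cons v vs ih =>
    rw [zonotope_cons] at hx
    obtain ⟨_, ⟨r, hr, rfl⟩, y, hy, rfl⟩ := Set.mem_add.1 hx
    rw [inner_add_right, zonotopeSupport, List.map_cons, List.sum_cons]
    refine add_le_add ?_ (ih hy)
    rw [real_inner_smul_right]
    refine (le_abs_self _).trans ?_
    rw [abs_mul]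
    exact mul_le_of_le_one_left (abs_nonneg _) (abs_le.2 hr)

theorem exists_inner_eq_zonotopeSupport (vs : List V) (u : V) :
    ∃ x ∈ zonotope vs, inner ℝ u x = zonotopeSupport vs u := by
  induction vs with
  | nil => exact ⟨0, rfl, by simp [zonotopeSupport]⟩
  | cons v vs ih =>
    obtain ⟨y, hy, e⟩ := ih
    have : ∃ r ∈ Set.Icc (-1 : ℝ) 1, r * inner ℝ u v = |inner ℝ u v| := by
      rcases le_total 0 (inner ℝ u v) with h | h
      · exact ⟨1, by simp, by rw [abs_of_nonneg h, one_mul]⟩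
      · exact ⟨-1, by simp, by rw [abs_of_nonpos h]; ring⟩
    obtain ⟨r, hr, e'⟩ := this
    refine ⟨r • v + y, ?_, ?_⟩
    · rw [zonotope_cons]
      exact Set.add_mem_add ⟨r, hr, rfl⟩ hy
    · rw [inner_add_right, e, real_inner_smul_right, e']
      simp [zonotopeSupport]

variable [FiniteDimensional ℝ V] [MeasurableSpace V] [BorelSpace V]

/-- By rotation invariance the average of `|⟨u, v⟩|` over all `v` in the unit ball is the same
positive number for all unit vectors `u`. -/
theorem exists_setAverage_abs_inner :
    ∃ c : ℝ, 0 < c ∧ ∀ u : V, ‖u‖ = 1 →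
      ⨍ v in Metric.closedBall (0 : V) 1, |inner ℝ u v| = c := by
  rcases subsingleton_or_nontrivial V with _ | _
  · exact ⟨1, one_pos, fun u hu => by simp [Subsingleton.elim u 0] at hu⟩
  obtain ⟨e, he⟩ := exists_norm_eq V zero_le_one
  have hfin : volume (Metric.closedBall (0 : V) 1) ≠ ⊤ := measure_closedBall_lt_top.ne
  have hball : 0 < volume (Metric.closedBall (0 : V) 1) :=
    Metric.measure_closedBall_pos _ _ one_pos
  have hcont : Continuous fun v : V => |inner ℝ e v| := by fun_prop
  refine ⟨⨍ v in Metric.closedBall (0 : V) 1, |inner ℝ e v|, ?_, ?_⟩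
  · rw [setAverage_eq, smul_eq_mul]
    refine mul_pos (inv_pos.2 (ENNReal.toReal_pos hball.ne' hfin)) ?_
    rw [setIntegral_pos_iff_support_of_nonneg_ae (Eventually.of_forall fun v => abs_nonneg _)
      (hcont.continuousOn.integrableOn_compact (isCompact_closedBall _ _))]
    have hopen : IsOpen (Function.support (fun v : V => |inner ℝ e v|) ∩ Metric.ball 0 1) :=
      (hcont.isOpen_support).inter Metric.isOpen_ball
    refine (hopen.measure_pos volume ⟨(2⁻¹ : ℝ) • e, ?_, ?_⟩).trans_le
      (measure_mono (Set.inter_subset_inter_right _ Metric.ball_subset_closedBall))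
    · simp [real_inner_smul_right, he]
    · simp [norm_smul, he]; norm_num
  · intro u hu
    rw [setAverage_eq, setAverage_eq]
    congr 1
    let g : V ≃ₗᵢ[ℝ] V := (Submodule.span ℝ {e - u})ᗮ.reflection
    have hg : g e = u := Submodule.reflection_sub (by rw [he, hu])
    have := (LinearIsometryEquiv.measurePreserving g).setIntegral_preimage_emb
      g.toHomeomorph.measurableEmbedding (fun v => |inner ℝ u v|) (Metric.closedBall 0 1)
    rw [← this, LinearIsometryEquiv.preimage_closedBall, map_zero]
    refine setIntegral_congr_fun measurableSet_closedBall fun v _ => ?_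
    simp only [← hg, LinearIsometryEquiv.inner_map_map]

/-- The Euclidean norm is, on the unit sphere, the uniform limit of support functions of
zonotopes: an average of the functions `|⟨·, v⟩|` lies in their closed convex hull. -/
theorem exists_zonotopeSupport_near_one {ε : ℝ} (hε : 0 < ε) :
    ∃ vs : List V, ∀ u : V, ‖u‖ = 1 → |zonotopeSupport vs u - 1| < ε := by
  obtain ⟨c, hc, havg⟩ := exists_setAverage_abs_inner (V := V)
  let S := Metric.sphere (0 : V) 1
  let Φ : C(V, C(S, ℝ)) := ContinuousMap.curry ⟨fun p : V × S => |inner ℝ (p.2 : V) p.1|,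
    by fun_prop⟩
  let Z : Set C(S, ℝ) := {g | ∃ vs : List V, ∀ u : S, g u = zonotopeSupport vs u}
  have hZ : Convex ℝ Z := by
    rintro g ⟨vs, hg⟩ h ⟨ws, hh⟩ a b ha hb -
    refine ⟨vs.map (a • ·) ++ ws.map (b • ·), fun u => ?_⟩
    simp only [ContinuousMap.add_apply, ContinuousMap.smul_apply, hg, hh, zonotopeSupport,
      List.map_append, List.sum_append, List.map_map, Function.comp_def, real_inner_smul_right,
      abs_mul, List.sum_map_mul_left, abs_of_nonneg ha, abs_of_nonneg hb, smul_eq_mul]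
  have hΦZ : ∀ v, Φ v ∈ Z := fun v => ⟨[v], fun u => by simp [Φ, zonotopeSupport]⟩
  have : NeZero (volume.restrict (Metric.closedBall (0 : V) 1)) :=
    ⟨by simpa [Measure.restrict_eq_zero] using
      (Metric.measure_closedBall_pos volume (0 : V) one_pos).ne'⟩
  have : IsFiniteMeasure (volume.restrict (Metric.closedBall (0 : V) 1)) :=
    isFiniteMeasure_restrict.2 measure_closedBall_lt_top.ne
  have hint : IntegrableOn Φ (Metric.closedBall (0 : V) 1) :=
    Φ.continuous.continuousOn.integrableOn_compact (isCompact_closedBall _ _)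
  have hmem : (⨍ v in Metric.closedBall (0 : V) 1, Φ v) ∈ closure Z :=
    hZ.closure.average_mem isClosed_closure
      (Eventually.of_forall fun v => subset_closure (hΦZ v)) hint
  have hval : ∀ u : S, (⨍ v in Metric.closedBall (0 : V) 1, Φ v) u = c := by
    intro u
    have := (ContinuousMap.evalCLM ℝ (M := ℝ) u).integral_comp_comm hint
    rw [← havg u (by simp), setAverage_eq, setAverage_eq, ContinuousMap.smul_apply]
    congr 1
    exact this.symm
  obtain ⟨g, ⟨vs, hg⟩, hdist⟩ := Metric.mem_closure_iff.1 hmem (ε * c) (by positivity)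
  refine ⟨vs.map (c⁻¹ • ·), fun u hu => ?_⟩
  have h1 := (ContinuousMap.dist_apply_le_dist (⟨u, mem_sphere_zero_iff_norm.2 hu⟩ : S)).trans_lt hdist
  rw [hval, hg, Real.dist_eq, abs_sub_comm] at h1
  have h2 : zonotopeSupport (vs.map (c⁻¹ • ·)) u = c⁻¹ * zonotopeSupport vs u := by
    simp only [zonotopeSupport, List.map_map, Function.comp_def, real_inner_smul_right,
      abs_mul, List.sum_map_mul_left, abs_of_pos (inv_pos.2 hc)]
  have h3 : c⁻¹ * zonotopeSupport vs u - 1 = c⁻¹ * (zonotopeSupport vs u - c) := by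
    field_simp
  rw [h2, h3, abs_mul, abs_of_pos (inv_pos.2 hc), inv_mul_lt_iff₀ hc, mul_comm]
  exact h1

/-- Balls are zonoids: the unit ball can be approximated by zonotopes. -/
theorem exists_zonotope_near_closedBall {ε : ℝ} (hε : 0 < ε) :
    ∃ vs : List V, Metric.closedBall 0 (1 - ε) ⊆ (zonotope vs : Set V) ∧
      (zonotope vs : Set V) ⊆ Metric.closedBall 0 (1 + ε) := by
  obtain ⟨vs, hvs⟩ := exists_zonotopeSupport_near_one (V := V) hε
  have hsupp : ∀ w : V, |zonotopeSupport vs w - ‖w‖| ≤ ε * ‖w‖ := by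
    intro w
    rcases eq_or_ne w 0 with rfl | hw
    · have := zonotopeSupport_smul vs 0 (0 : V)
      rw [smul_zero, abs_zero, zero_mul] at this
      simp [this]
    · have hw' : 0 < ‖w‖ := norm_pos_iff.2 hw
      have h1 := hvs (‖w‖⁻¹ • w) (by rw [norm_smul, norm_inv, norm_norm, inv_mul_cancel₀ hw'.ne'])
      rw [zonotopeSupport_smul, abs_of_pos (inv_pos.2 hw')] at h1
      have h2 : zonotopeSupport vs w - ‖w‖ = ‖w‖ * (‖w‖⁻¹ * zonotopeSupport vs w - 1) := by
        field_simp
      rw [h2, abs_mul, abs_of_pos hw', mul_comm]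
      exact mul_le_mul_of_nonneg_right h1.le hw'.le
  refine ⟨vs, fun x hx => ?_, fun x hx => ?_⟩
  · rw [mem_closedBall_zero_iff] at hx
    by_contra hxZ
    obtain ⟨f, s, hf, hs⟩ := geometric_hahn_banach_closed_point (zonotope vs).convex
      (zonotope vs).isClosed hxZ
    obtain ⟨w, rfl⟩ := (InnerProductSpace.toDual ℝ V).surjective f
    simp only [InnerProductSpace.toDual_apply_apply] at hf hs
    obtain ⟨y, hy, e⟩ := exists_inner_eq_zonotopeSupport vs w
    have h1 := hf y hy
    have h2 := (abs_le.1 (hsupp w)).1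
    have h3 := real_inner_le_norm w x
    have h4 := mul_le_mul_of_nonneg_left hx (norm_nonneg w)
    rw [e] at h1
    linarith
  · rw [mem_closedBall_zero_iff]
    have h1 := inner_le_zonotopeSupport x hx
    rw [real_inner_self_eq_norm_sq] at h1
    have h2 := (abs_le.1 (hsupp x)).2
    by_contra! h
    have hx0 : 0 < ‖x‖ := by linarith
    nlinarith [mul_lt_mul_of_pos_right h hx0]

end Zonoid

/-! ### The Steiner formula and the quermassintegrals -/

section Steiner

variable {V : Type*} [NormedAddCommGroup V] [NormedSpace ℝ V]

/-- The convex body `{x}`. -/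
def pointBody (x : V) : ConvexBody V :=
  ⟨{x}, convex_singleton _, isCompact_singleton, Set.singleton_nonempty _⟩

@[simp] theorem coe_pointBody (x : V) : (pointBody x : Set V) = {x} := rfl

theorem measureReal_pointBody_add [MeasurableSpace V] [BorelSpace V] (μ : Measure V)
    [μ.IsAddLeftInvariant] (x : V) (K : ConvexBody V) :
    μ.real ((pointBody x + K : ConvexBody V) : Set V) = μ.real (K : Set V) := by
  rw [← measureReal_vadd_eq μ x (K : Set V), ← Set.singleton_vadd]
  rfl

theorem exists_zero_mem_pointBody_add (K : ConvexBody V) :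
    ∃ x : V, (0 : V) ∈ pointBody x + K := by
  obtain ⟨x, hx⟩ := K.nonempty
  exact ⟨-x, Set.mem_add.2 ⟨-x, rfl, x, hx, by simp⟩⟩

theorem ConvexBody.smul_subset_smul {K : ConvexBody V} (h0 : (0 : V) ∈ K) {a b : ℝ} (ha : 0 ≤ a)
    (hab : a ≤ b) : ((a • K : ConvexBody V) : Set V) ⊆ (b • K : ConvexBody V) := by
  lift a to NNReal using ha
  lift b to NNReal using a.2.trans hab
  exact ConvexBody.smul_le_of_le K h0 (by exact_mod_cast hab)

variable [FiniteDimensional ℝ V]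

/-- The closed unit ball as a convex body. -/
def ballBody (V : Type*) [NormedAddCommGroup V] [NormedSpace ℝ V] [FiniteDimensional ℝ V] :
    ConvexBody V :=
  have := FiniteDimensional.proper_real V
  ⟨Metric.closedBall 0 1, convex_closedBall _ _, isCompact_closedBall _ _, ⟨0, by simp⟩⟩

@[simp] theorem coe_ballBody : (ballBody V : Set V) = Metric.closedBall 0 1 := rfl

theorem coe_smul_ballBody {r : ℝ} (hr : 0 ≤ r) :
    ((r • ballBody V : ConvexBody V) : Set V) = Metric.closedBall 0 r := by
  rw [ConvexBody.coe_smul, coe_ballBody, smul_unitClosedBall_of_nonneg hr]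

variable [MeasurableSpace V] [BorelSpace V] (μ : Measure V) [μ.IsAddHaarMeasure]

theorem measureReal_add_smul_mem_Icc {Z : ConvexBody V} {ε : ℝ} (hε : 0 < ε) (hε1 : ε < 1)
    (h1 : Metric.closedBall 0 (1 - ε) ⊆ (Z : Set V))
    (h2 : (Z : Set V) ⊆ Metric.closedBall 0 (1 + ε)) (K : ConvexBody V) (ρ : ℝ) :
    μ.real ((K + ρ • Z : ConvexBody V) : Set V) ∈
      Set.Icc ((1 - ε) ^ Module.finrank ℝ V *
          μ.real ((K + ρ • ballBody V : ConvexBody V) : Set V))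
        ((1 + ε) ^ Module.finrank ℝ V *
          μ.real ((K + ρ • ballBody V : ConvexBody V) : Set V)) := by
  wlog h0 : (0 : V) ∈ K generalizing K
  · obtain ⟨x, hx⟩ := exists_zero_mem_pointBody_add K
    have := this (pointBody x + K) hx
    rwa [add_assoc, add_assoc, measureReal_pointBody_add, measureReal_pointBody_add] at this
  rw [← coe_smul_ballBody (by linarith)] at h1 h2
  -- since `0 ∈ K`, the bodies `(1 ± ε) K` are comparable with `K`
  constructor
  · rw [← measureReal_smul_eq μ _ (by linarith : 0 < 1 - ε)]
    refine measureReal_mono ?_ (K + ρ • Z).isCompact.measure_lt_top.ne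
    rw [smul_add, smul_comm, ConvexBody.coe_add, ConvexBody.coe_add, ConvexBody.coe_smul ρ,
      ConvexBody.coe_smul ρ]
    refine Set.add_subset_add ?_ (Set.smul_set_mono h1)
    simpa using ConvexBody.smul_subset_smul h0 (by linarith) (by linarith : 1 - ε ≤ 1)
  · rw [← measureReal_smul_eq μ _ (by linarith : 0 < 1 + ε)]
    refine measureReal_mono ?_ ((1 + ε) • (K + ρ • ballBody V)).isCompact.measure_lt_top.ne
    rw [smul_add, smul_comm _ ρ, ConvexBody.coe_add, ConvexBody.coe_add, ConvexBody.coe_smul ρ,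
      ConvexBody.coe_smul ρ]
    refine Set.add_subset_add ?_ (Set.smul_set_mono h2)
    simpa using ConvexBody.smul_subset_smul h0 zero_le_one (by linarith : 1 ≤ 1 + ε)

end Steiner

/-- There is a sequence of zonotopes along which all outer parallel volumes converge to those for
the unit ball. -/
theorem exists_zonotope_tendsto {V : Type*} [NormedAddCommGroup V] [InnerProductSpace ℝ V]
    [FiniteDimensional ℝ V] [MeasurableSpace V] [BorelSpace V] (μ : Measure V)
    [μ.IsAddHaarMeasure] :
    ∃ vs : ℕ → List V, ∀ (K : ConvexBody V) (ρ : ℝ),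
      Tendsto (fun m => μ.real ((K + ρ • zonotope (vs m) : ConvexBody V) : Set V)) atTop
        (𝓝 (μ.real ((K + ρ • ballBody V : ConvexBody V) : Set V))) := by
  have hpos : ∀ m : ℕ, (0 : ℝ) < 1 / ((m : ℝ) + 1) / 2 := fun m => by positivity
  have hlt : ∀ m : ℕ, 1 / ((m : ℝ) + 1) / 2 < 1 := fun m => by
    have : 1 / ((m : ℝ) + 1) ≤ 1 := by
      rw [div_le_one (by positivity)]
      linarith [Nat.cast_nonneg (α := ℝ) m]
    linarith
  choose vs h1 h2 using fun m : ℕ => exists_zonotope_near_closedBall (V := V) (hpos m)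
  refine ⟨vs, fun K ρ => ?_⟩
  have hlim : Tendsto (fun m : ℕ => 1 / ((m : ℝ) + 1) / 2) atTop (𝓝 0) := by
    simpa using (tendsto_one_div_add_atTop_nhds_zero_nat (𝕜 := ℝ)).div_const 2
  have hmem := fun m => measureReal_add_smul_mem_Icc μ (hpos m) (hlt m) (h1 m) (h2 m) K ρ
  refine tendsto_of_tendsto_of_tendsto_of_le_of_le ?_ ?_ (fun m => (hmem m).1)
    (fun m => (hmem m).2)
  · simpa using ((hlim.const_sub 1).pow (Module.finrank ℝ V)).mul_const
      (μ.real ((K + ρ • ballBody V : ConvexBody V) : Set V))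
  · simpa using ((hlim.const_add 1).pow (Module.finrank ℝ V)).mul_const
      (μ.real ((K + ρ • ballBody V : ConvexBody V) : Set V))

section Quermassintegral

variable {n : ℕ}

/-- The coefficients of the polynomial of degree at most `n` interpolating `y` at `0, …, n`
depend continuously on `y`. -/
theorem tendsto_coeff_interpolate {y : ℕ → ℕ → ℝ} {z : ℕ → ℝ}
    (h : ∀ i, Tendsto (fun m => y m i) atTop (𝓝 (z i))) (l : ℕ) :
    Tendsto (fun m => (Lagrange.interpolate (Finset.range (n + 1)) (fun i : ℕ => (i : ℝ))
      (y m)).coeff l) atTop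
      (𝓝 ((Lagrange.interpolate (Finset.range (n + 1)) (fun i : ℕ => (i : ℝ)) z).coeff l)) := by
  simp only [Lagrange.interpolate_apply, Polynomial.finsetSum_coeff, Polynomial.coeff_C_mul]
  exact tendsto_finsetSum _ fun i _ => (h i).mul_const _

theorem coeff_interpolate_eq {y a : ℕ → ℝ}
    (h : ∀ i : ℕ, y i = ∑ j ∈ Finset.range (n + 1), (i : ℝ) ^ j * a j) {l : ℕ} (hl : l ≤ n) :
    (Lagrange.interpolate (Finset.range (n + 1)) (fun i : ℕ => (i : ℝ)) y).coeff l = a l := by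
  have hp : (∑ j ∈ Finset.range (n + 1), Polynomial.monomial j (a j)) =
      Lagrange.interpolate (Finset.range (n + 1)) (fun i : ℕ => (i : ℝ)) y := by
    refine Lagrange.eq_interpolate_of_eval_eq _ (fun a _ b _ h => by exact_mod_cast h) ?_ ?_
    · rw [Finset.card_range, Polynomial.degree_lt_iff_coeff_zero]
      intro m hm
      rw [Polynomial.finsetSum_coeff]
      refine Finset.sum_eq_zero fun i hi => ?_
      rw [Polynomial.coeff_monomial, if_neg]
      have := Finset.mem_range.1 hi
      omega
    · intro i _
      simp only [Polynomial.eval_finsetSum, Polynomial.eval_monomial, h, mul_comm]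
  rw [← hp, Polynomial.finsetSum_coeff, Finset.sum_eq_single l]
  · rw [Polynomial.coeff_monomial, if_pos rfl]
  · intro b _ hb
    rw [Polynomial.coeff_monomial, if_neg hb]
  · intro h
    exact absurd (Finset.mem_range.2 (by omega)) h

theorem parallelVolume_eq (K : Kn n) (ρ : ℝ) :
    parallelVolume K ρ =
      volume.real ((K + ρ • ballBody (EuclideanSpace ℝ (Fin n)) : Kn n) :
        Set (EuclideanSpace ℝ (Fin n))) := rfl

/-- The Steiner formula, together with the monotonicity of its coefficients. -/
theorem steiner_formula :
    (∀ l ≤ n, SegmentAffine (fun K : Kn n => (steinerPolynomial K).coeff l)) ∧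
      ∀ (K : Kn n) (ρ : ℝ), 0 ≤ ρ → parallelVolume K ρ =
        ∑ j ∈ Finset.range (n + 1), ρ ^ j * (steinerPolynomial K).coeff j := by
  obtain ⟨vs, hvs⟩ := exists_zonotope_tendsto
    (volume : Measure (EuclideanSpace ℝ (Fin n)))
  choose a ha hexp using fun m => exists_measureReal_add_smul_zonotope
    (volume : Measure (EuclideanSpace ℝ (Fin n))) (vs m)
  rw [finrank_euclideanSpace_fin] at hexp
  have hlim : ∀ l ≤ n, ∀ K : Kn n,
      Tendsto (fun m => a m l K) atTop (𝓝 ((steinerPolynomial K).coeff l)) := by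
    intro l hl K
    refine (tendsto_coeff_interpolate (n := n)
      (fun i : ℕ => hvs K i) l).congr fun m => ?_
    exact coeff_interpolate_eq (fun i : ℕ => hexp m K i (Nat.cast_nonneg i)) hl
  refine ⟨fun l hl => SegmentAffine.of_tendsto (fun m => ha m l) (hlim l hl), fun K ρ hρ => ?_⟩
  refine tendsto_nhds_unique (hvs K ρ) ?_
  simp only [fun m => hexp m K ρ hρ]
  exact tendsto_finsetSum _ fun j hj =>
    (hlim j (Nat.lt_succ_iff.1 (Finset.mem_range.1 hj)) K).const_mul _

theorem segmentAffine_quermassintegral {l : ℕ} (hl : l ≤ n) :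
    SegmentAffine (fun K : Kn n => quermassintegral l K) where
  mono h := div_le_div_of_nonneg_right ((steiner_formula.1 l hl).mono h) (Nat.cast_nonneg _)
  affine K v t ht := by
    simp only [quermassintegral, (steiner_formula.1 l hl).affine K v ht]
    ring

theorem parallelVolume_eq_sum (K : Kn n) {ρ : ℝ} (hρ : 0 ≤ ρ) : parallelVolume K ρ =
    ∑ j ∈ Finset.range (n + 1), ρ ^ j * ((n.choose j : ℝ) * quermassintegral j K) := by
  rw [steiner_formula.2 K ρ hρ]
  refine Finset.sum_congr rfl fun j hj => ?_
  have hc : (n.choose j : ℝ) ≠ 0 := by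
    exact_mod_cast (Nat.choose_pos (Nat.lt_succ_iff.1 (Finset.mem_range.1 hj))).ne'
  rw [quermassintegral, mul_div_cancel₀ _ hc]

theorem quermassintegral_pointBody_add (x : EuclideanSpace ℝ (Fin n)) (K : Kn n) (l : ℕ) :
    quermassintegral l (pointBody x + K) = quermassintegral l K := by
  have : ∀ ρ, parallelVolume (pointBody x + K) ρ = parallelVolume K ρ := by
    intro ρ
    rw [parallelVolume_eq, parallelVolume_eq, add_assoc, measureReal_pointBody_add]
  simp only [quermassintegral, steinerPolynomial, this]

theorem quermassintegral_smul {l : ℕ} (hl : l ≤ n) (K : Kn n) {t : ℝ} (ht : 0 < t) :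
    quermassintegral l (t • K) = t ^ (n - l) * quermassintegral l K := by
  have h := coeff_unique (m := n + 1)
    (a := fun j => t ^ j * ((n.choose j : ℝ) * quermassintegral j (t • K)))
    (b := fun j => t ^ n * ((n.choose j : ℝ) * quermassintegral j K)) ?_ (Nat.lt_succ_of_le hl)
  · have hc : (n.choose l : ℝ) ≠ 0 := by exact_mod_cast (Nat.choose_pos hl).ne'
    have e : t ^ n = t ^ l * t ^ (n - l) := by rw [← pow_add, Nat.add_sub_cancel' hl]
    rw [e] at h
    have h' : t ^ l * (n.choose l : ℝ) * quermassintegral l (t • K) =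
        t ^ l * (n.choose l : ℝ) * (t ^ (n - l) * quermassintegral l K) := by linarith
    exact mul_left_cancel₀ (mul_ne_zero (by positivity) hc) h'
  · intro ρ hρ
    have e : t • K + (t * ρ) • ballBody (EuclideanSpace ℝ (Fin n)) =
        t • (K + ρ • ballBody (EuclideanSpace ℝ (Fin n))) := by rw [smul_add, smul_smul]
    have h1 := parallelVolume_eq_sum (t • K) (ρ := t * ρ) (by positivity)
    rw [parallelVolume_eq, e, measureReal_smul_eq _ _ ht, finrank_euclideanSpace_fin,
      ← parallelVolume_eq, parallelVolume_eq_sum K hρ.le, Finset.mul_sum] at h1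
    calc _ = ∑ j ∈ Finset.range (n + 1),
          (t * ρ) ^ j * ((n.choose j : ℝ) * quermassintegral j (t • K)) :=
          Finset.sum_congr rfl fun j _ => by rw [mul_pow]; ring
      _ = _ := by
          rw [← h1]
          exact Finset.sum_congr rfl fun j _ => by ring

theorem quermassintegral_zero {l : ℕ} (hl : l < n) : quermassintegral l (0 : Kn n) = 0 := by
  have h := quermassintegral_smul hl.le (0 : Kn n) two_pos
  rw [show (2 : ℝ) • (0 : Kn n) = 0 from
    SetLike.ext' (smul_zero (2 : ℝ))] at h
  have : (1 : ℝ) < 2 ^ (n - l) := one_lt_pow₀ one_lt_two (by omega)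
  nlinarith

theorem quermassintegral_nonneg {l : ℕ} (hl : l < n) (K : Kn n) : 0 ≤ quermassintegral l K := by
  obtain ⟨x, hx⟩ := exists_zero_mem_pointBody_add K
  rw [← quermassintegral_pointBody_add x K, ← quermassintegral_zero hl]
  refine (segmentAffine_quermassintegral hl.le).mono ?_
  exact Set.zero_subset.2 hx

theorem quermassintegral_zonotope_eq_zero {l : ℕ} {vs : List (EuclideanSpace ℝ (Fin n))}
    (h : vs.length + l < n) : quermassintegral l (zonotope vs) = 0 :=
  (segmentAffine_quermassintegral (by omega : l ≤ n)).zonotope_eq_zero (d := n - l)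
    (fun K _ ht => quermassintegral_smul (by omega) K ht) (by omega)

end Quermassintegral

/-! ### The operators `K ↦ a K + b (-K)` -/

section ReflectionBody

theorem Convex.sum_mem_card_smul {V ι : Type*} [AddCommGroup V] [Module ℝ V] {s : Set V}
    (hs : Convex ℝ s) (hne : s.Nonempty) (I : Finset ι) (f : ι → V) (hf : ∀ i ∈ I, f i ∈ s) :
    ∑ i ∈ I, f i ∈ (I.card : ℝ) • s := by
  classical
  induction I using Finset.induction_on with
  | empty => simp [Set.zero_smul_set hne]
  | insert i I hi ih =>
    rw [Finset.sum_insert hi, Finset.card_insert_of_notMem hi, add_comm (f i), Nat.cast_add,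
      hs.add_smul (Nat.cast_nonneg _) (by norm_num)]
    refine Set.add_mem_add (ih fun j hj => hf j (Finset.mem_insert_of_mem hj)) ?_
    simpa using hf i (Finset.mem_insert_self _ _)

/-- A translate of `-K` is contained in `dim V • K`. By Helly's theorem it is enough to find a
common point of the sets `x + dim V • K` for at most `dim V + 1` points `x` of `K`, and the sum
of these points, padded to `dim V + 1` summands, is one. -/
theorem ConvexBody.exists_sub_mem_smul {V : Type*} [NormedAddCommGroup V] [NormedSpace ℝ V]
    [FiniteDimensional ℝ V] (K : ConvexBody V) :
    ∃ z : V, ∀ x ∈ K, z - x ∈ (Module.finrank ℝ V : ℝ) • (K : Set V) := by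
  classical
  set d := Module.finrank ℝ V with hd
  have h := Convex.helly_theorem_compact' (𝕜 := ℝ)
    (F := fun x : (K : Set V) => (x : V) +ᵥ ((d : ℝ) • (K : Set V)))
    (fun x => (K.convex.smul _).vadd _) (fun x => (K.isCompact.smul _).vadd _) ?_
  · obtain ⟨z, hz⟩ := h
    refine ⟨z, fun x hx => ?_⟩
    have := Set.mem_iInter.1 hz ⟨x, hx⟩
    rwa [Set.mem_vadd_set_iff_neg_vadd_mem, vadd_eq_add, neg_add_eq_sub] at this
  · intro I hI
    obtain ⟨x₀, hx₀⟩ := K.nonempty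
    refine ⟨∑ x ∈ I, (x : V) + ((d + 1 - I.card : ℕ) : ℝ) • x₀, Set.mem_iInter₂.2 fun x hx => ?_⟩
    rw [Set.mem_vadd_set_iff_neg_vadd_mem, vadd_eq_add, neg_add_eq_sub, add_sub_right_comm]
    have hc : (I.erase x).card + (d + 1 - I.card) = d := by
      have := Finset.card_pos.2 ⟨x, hx⟩
      rw [Finset.card_erase_of_mem hx]
      omega
    have e : (d : ℝ) • (K : Set V) =
        ((I.erase x).card : ℝ) • (K : Set V) + ((d + 1 - I.card : ℕ) : ℝ) • (K : Set V) := by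
      rw [← K.convex.add_smul (Nat.cast_nonneg _) (Nat.cast_nonneg _), ← Nat.cast_add, hc]
    rw [e]
    refine Set.add_mem_add ?_ (Set.smul_mem_smul_set hx₀)
    rw [← Finset.sum_erase_add _ _ hx, add_sub_cancel_right]
    exact K.convex.sum_mem_card_smul K.nonempty _ _ fun y _ => y.2

end ReflectionBody

section Sufficiency

variable {n : ℕ} {D : Kn n → Kn n} {a b : ℝ}

theorem dist_le_of_eq_smul_add_smul_neg (ha : 0 ≤ a) (hb : 0 ≤ b)
    (hD : ∀ K : Kn n, (D K : Set (EuclideanSpace ℝ (Fin n))) =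
      a • (K : Set (EuclideanSpace ℝ (Fin n))) + b • (-(K : Set (EuclideanSpace ℝ (Fin n)))))
    (K L : Kn n) : dist (D K) (D L) ≤ (a + b) * dist K L := by
  have half : ∀ (K L : Kn n) (r : ℝ), dist K L < r →
      ∀ x ∈ (D K : Set (EuclideanSpace ℝ (Fin n))),
        ∃ y ∈ (D L : Set (EuclideanSpace ℝ (Fin n))), dist x y ≤ (a + b) * r := by
    intro K L r hr x hx
    rw [hD] at hx
    obtain ⟨_, ⟨p, hp, rfl⟩, _, ⟨q, hq, rfl⟩, rfl⟩ := Set.mem_add.1 hx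
    rw [← ConvexBody.hausdorffDist_coe] at hr
    obtain ⟨p', hp', h1⟩ := Metric.exists_dist_lt_of_hausdorffDist_lt hp hr
      ConvexBody.hausdorffEDist_ne_top
    obtain ⟨q', hq', h2⟩ := Metric.exists_dist_lt_of_hausdorffDist_lt (Set.mem_neg.1 hq) hr
      ConvexBody.hausdorffEDist_ne_top
    refine ⟨a • p' + b • (-q'), ?_, ?_⟩
    · rw [hD]
      exact Set.add_mem_add (Set.smul_mem_smul_set hp')
        (Set.smul_mem_smul_set (Set.neg_mem_neg.2 hq'))
    · refine (dist_add_add_le _ _ _ _).trans ?_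
      simp only [dist_smul₀, Real.norm_of_nonneg ha, Real.norm_of_nonneg hb]
      rw [add_mul, ← dist_neg_neg q, neg_neg]
      exact add_le_add (mul_le_mul_of_nonneg_left h1.le ha)
        (mul_le_mul_of_nonneg_left h2.le hb)
  have step : ∀ r, dist K L < r → dist (D K) (D L) ≤ (a + b) * r := fun r hr =>
    Metric.hausdorffDist_le_of_mem_dist
      (mul_nonneg (add_nonneg ha hb) (dist_nonneg.trans hr.le))
      (half K L r hr) (half L K r (by rwa [dist_comm]))
  have lim : Tendsto (fun r => (a + b) * r) (𝓝[>] (dist K L)) (𝓝 ((a + b) * dist K L)) :=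
    ((continuous_const.mul continuous_id).tendsto _).mono_left nhdsWithin_le_nhds
  exact ge_of_tendsto lim (eventually_mem_nhdsWithin.mono step)

theorem continuous_of_eq_smul_add_smul_neg (ha : 0 ≤ a) (hb : 0 ≤ b)
    (hD : ∀ K : Kn n, (D K : Set (EuclideanSpace ℝ (Fin n))) =
      a • (K : Set (EuclideanSpace ℝ (Fin n))) + b • (-(K : Set (EuclideanSpace ℝ (Fin n))))) :
    Continuous D :=
  (LipschitzWith.of_dist_le' (dist_le_of_eq_smul_add_smul_neg ha hb hD)).continuous

theorem glCovariant_of_eq_smul_add_smul_neg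
    (hD : ∀ K : Kn n, (D K : Set (EuclideanSpace ℝ (Fin n))) =
      a • (K : Set (EuclideanSpace ℝ (Fin n))) + b • (-(K : Set (EuclideanSpace ℝ (Fin n))))) :
    GLCovariant D := by
  intro g K
  refine SetLike.coe_injective ?_
  rw [hD]
  change a • (g '' (K : Set (EuclideanSpace ℝ (Fin n)))) +
    b • -(g '' (K : Set (EuclideanSpace ℝ (Fin n)))) = g '' (D K)
  rw [hD, Set.image_add, image_smul_set, image_smul_set, Set.image_neg]

theorem rogersShephardType_of_eq_smul_add_smul_neg (ha : 0 ≤ a) (hb : 0 ≤ b)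
    (hD : ∀ K : Kn n, (D K : Set (EuclideanSpace ℝ (Fin n))) =
      a • (K : Set (EuclideanSpace ℝ (Fin n))) + b • (-(K : Set (EuclideanSpace ℝ (Fin n)))))
    {l : ℕ} (hl : l < n) : RogersShephardType (quermassintegral l) D := by
  have hc : 0 < a + b * n + 1 := by positivity
  refine ⟨(a + b * n + 1) ^ (n - l), by positivity, fun K => ?_⟩
  obtain ⟨x₀, hx₀⟩ := K.nonempty
  obtain ⟨z, hz⟩ := K.exists_sub_mem_smul
  rw [finrank_euclideanSpace_fin] at hz
  rw [← quermassintegral_smul hl.le K hc,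
    ← quermassintegral_pointBody_add (-x₀ - b • z) ((a + b * n + 1) • K)]
  refine (segmentAffine_quermassintegral hl.le).mono ?_
  rw [hD]
  rintro _ ⟨_, ⟨p, hp, rfl⟩, _, ⟨q, hq, rfl⟩, rfl⟩
  obtain ⟨y, hy, e⟩ := Set.mem_smul_set.1 (hz (-q) hq)
  refine Set.mem_add.2 ⟨_, rfl, a • p + (b * n) • y + x₀, ?_, ?_⟩
  · rw [ConvexBody.coe_smul, K.convex.add_smul (by positivity) zero_le_one,
      K.convex.add_smul ha (by positivity), one_smul]
    exact Set.add_mem_add (Set.add_mem_add (Set.smul_mem_smul_set hp)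
      (Set.smul_mem_smul_set hy)) hx₀
  · have e' : (n : ℝ) • y = z - -q := e
    rw [mul_smul, e']
    simp only [smul_sub, smul_neg]
    abel

end Sufficiency

/-! ### Continuous covariant operators commute with singular linear maps -/

section LinearImage

variable {V : Type*} [NormedAddCommGroup V] [NormedSpace ℝ V]

/-- The image of a convex body under a continuous linear map, not necessarily invertible. -/
def linImage (g : V →L[ℝ] V) (K : ConvexBody V) : ConvexBody V where
  carrier := g '' (K : Set V)
  convex' := K.convex.is_linear_image g.toLinearMap.isLinear
  isCompact' := K.isCompact.image g.continuous
  nonempty' := K.nonempty.image g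

@[simp] theorem coe_linImage (g : V →L[ℝ] V) (K : ConvexBody V) :
    (linImage g K : Set V) = g '' (K : Set V) := rfl

theorem tendsto_linImage {ι : Type*} {F : Filter ι} {g : ι → V →L[ℝ] V} {g₀ : V →L[ℝ] V}
    (h : Tendsto g F (𝓝 g₀)) (K : ConvexBody V) :
    Tendsto (fun i => linImage (g i) K) F (𝓝 (linImage g₀ K)) := by
  obtain ⟨R, hR, hK⟩ := K.isBounded.exists_pos_norm_le
  rw [tendsto_iff_dist_tendsto_zero]
  have hlim : Tendsto (fun i => ‖g i - g₀‖ * R) F (𝓝 0) := by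
    simpa using (tendsto_iff_norm_sub_tendsto_zero.1 h).mul_const R
  refine squeeze_zero (fun _ => dist_nonneg) (fun i => ?_) hlim
  have key : ∀ x ∈ K, dist (g i x) (g₀ x) ≤ ‖g i - g₀‖ * R := fun x hx => by
    rw [dist_eq_norm, ← sub_apply]
    exact (ContinuousLinearMap.le_opNorm _ _).trans
      (mul_le_mul_of_nonneg_left (hK x hx) (norm_nonneg _))
  refine Metric.hausdorffDist_le_of_mem_dist (by positivity) ?_ ?_
  · rintro _ ⟨x, hx, rfl⟩
    exact ⟨g₀ x, ⟨x, hx, rfl⟩, key x hx⟩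
  · rintro _ ⟨x, hx, rfl⟩
    exact ⟨g i x, ⟨x, hx, rfl⟩, by rw [dist_comm]; exact key x hx⟩

end LinearImage

/-- A continuous `GL(n)`-covariant operator commutes with all linear maps, since the invertible
ones are dense. -/
theorem GLCovariant.map_linImage {n : ℕ} {D : Kn n → Kn n} (hD : GLCovariant D) (hc : Continuous D)
    (g : EuclideanSpace ℝ (Fin n) →L[ℝ] EuclideanSpace ℝ (Fin n)) (K : Kn n) :
    D (linImage g K) = linImage g (D K) := by
  let G : ℝ → EuclideanSpace ℝ (Fin n) →L[ℝ] EuclideanSpace ℝ (Fin n) :=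
    fun t => g - t • ContinuousLinearMap.id ℝ _
  have hG : Tendsto G (𝓝[≠] 0) (𝓝 g) := by
    have : Continuous G := by fun_prop
    have h0 : G 0 = g := ContinuousLinearMap.ext fun x => by simp [G]
    exact h0 ▸ (this.tendsto 0).mono_left nhdsWithin_le_nhds
  have hfin := Module.End.finite_spectrum (g : Module.End ℝ (EuclideanSpace ℝ (Fin n)))
  have hev : ∀ᶠ t in 𝓝[≠] (0 : ℝ), D (linImage (G t) K) =
      linImage (G t) (D K) := by
    filter_upwards [nhdsNE_le_cofinite 0 hfin.compl_mem_cofinite] with t ht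
    have hu := (spectrum.notMem_iff.1 ht).neg
    rw [neg_sub, Module.End.isUnit_iff] at hu
    let e := (LinearEquiv.ofBijective _ hu).toContinuousLinearEquiv
    have he : ∀ L : Kn n, linImage (G t) L = Kn.image e L := by
      intro L
      refine SetLike.coe_injective ?_
      change G t '' (L : Set _) = e '' (L : Set _)
      refine Set.image_congr fun x _ => ?_
      simp [G, e, Module.algebraMap_end_apply]
    rw [he, he, hD]
  exact tendsto_nhds_unique ((hc.tendsto _).comp (tendsto_linImage hG K))
    ((tendsto_linImage hG (D K)).congr' (hev.mono fun t h => h.symm))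

/-! ### Support functions -/

section Support

variable {V : Type*} [NormedAddCommGroup V] [InnerProductSpace ℝ V]

/-- The support function `u ↦ max {⟨u, x⟩ : x ∈ K}` of a convex body. -/
noncomputable def supp (K : ConvexBody V) (u : V) : ℝ :=
  sSup ((fun x => inner ℝ u x) '' (K : Set V))

theorem isGreatest_supp (K : ConvexBody V) (u : V) :
    IsGreatest ((fun x => inner ℝ u x) '' (K : Set V)) (supp K u) :=
  (K.isCompact.image (by fun_prop)).isGreatest_sSup (K.nonempty.image _)

theorem inner_le_supp {K : ConvexBody V} (u : V) {x : V} (hx : x ∈ K) : inner ℝ u x ≤ supp K u :=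
  (isGreatest_supp K u).2 ⟨x, hx, rfl⟩

theorem exists_inner_eq_supp (K : ConvexBody V) (u : V) : ∃ x ∈ K, inner ℝ u x = supp K u :=
  (isGreatest_supp K u).1

theorem supp_eq_of_isGreatest {K : ConvexBody V} {u : V} {c : ℝ} (h : ∀ x ∈ K, inner ℝ u x ≤ c)
    (h' : ∃ x ∈ K, inner ℝ u x = c) : supp K u = c := by
  obtain ⟨x, hx, rfl⟩ := h'
  obtain ⟨y, hy, e⟩ := exists_inner_eq_supp K u
  exact le_antisymm (e ▸ h y hy) (inner_le_supp u hx)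

theorem supp_add_le (K : ConvexBody V) (u v : V) : supp K (u + v) ≤ supp K u + supp K v := by
  obtain ⟨x, hx, e⟩ := exists_inner_eq_supp K (u + v)
  rw [← e, inner_add_left]
  exact add_le_add (inner_le_supp u hx) (inner_le_supp v hx)

theorem supp_smul (K : ConvexBody V) {t : ℝ} (ht : 0 ≤ t) (u : V) :
    supp K (t • u) = t * supp K u := by
  refine supp_eq_of_isGreatest (fun x hx => ?_) ?_
  · rw [real_inner_smul_left]
    exact mul_le_mul_of_nonneg_left (inner_le_supp u hx) ht
  · obtain ⟨x, hx, e⟩ := exists_inner_eq_supp K u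
    exact ⟨x, hx, by rw [real_inner_smul_left, e]⟩

theorem subset_of_supp_le [CompleteSpace V] {K L : ConvexBody V} (h : ∀ u, supp K u ≤ supp L u) :
    (K : Set V) ⊆ L := by
  intro x hx
  by_contra hxL
  obtain ⟨f, s, hf, hs⟩ := geometric_hahn_banach_closed_point L.convex L.isClosed hxL
  obtain ⟨w, rfl⟩ := (InnerProductSpace.toDual ℝ V).surjective f
  simp only [InnerProductSpace.toDual_apply_apply] at hf hs
  obtain ⟨y, hy, e⟩ := exists_inner_eq_supp L w
  have h1 := hf y hy
  have h2 := inner_le_supp w hx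
  linarith [h w]

theorem eq_of_supp_eq [CompleteSpace V] {K L : ConvexBody V} (h : ∀ u, supp K u = supp L u) :
    (K : Set V) = L :=
  (subset_of_supp_le fun u => (h u).le).antisymm (subset_of_supp_le fun u => (h u).ge)

/-- The convex hull of three points. -/
def triangle (P : Fin 3 → V) : ConvexBody V where
  carrier := convexHull ℝ (Set.range P)
  convex' := convex_convexHull _ _
  isCompact' := (Set.finite_range P).isCompact_convexHull ℝ
  nonempty' := (Set.range_nonempty P).convexHull

/-- The segment from `s e` to `t e`. -/
def lineSegment (e : V) (s t : ℝ) : ConvexBody V where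
  carrier := (fun r : ℝ => r • e) '' Set.uIcc s t
  convex' := (convex_uIcc s t).is_linear_image (LinearMap.toSpanSingleton ℝ V e).isLinear
  isCompact' := isCompact_uIcc.image (by fun_prop)
  nonempty' := Set.nonempty_uIcc.image _

end Support

/-! ### The profile of a continuous covariant operator -/

section Profile

variable {n : ℕ} [NeZero n] {D : Kn n → Kn n}

/-- A continuous `GL(n)`-covariant operator `D` maps the segment `[s, t] e` to a segment
`[-r', r] e`, where `e` is the first basis vector. The number `r` determines `D`, see
`supp_eq_profile`. -/
noncomputable def profile (D : Kn n → Kn n) (s t : ℝ) : ℝ :=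
  supp (D (lineSegment (EuclideanSpace.single 0 1) s t)) (EuclideanSpace.single 0 1)

/-- Projecting `K` to the line in direction `u` shows that `supp (D K) u` depends only on the
range `[s, t]` of `⟨u, ·⟩` on `K`. -/
theorem supp_eq_profile (hD : GLCovariant D) (hc : Continuous D) {K : Kn n}
    {u : EuclideanSpace ℝ (Fin n)} {s t : ℝ} (hs : ∃ x ∈ K, inner ℝ u x = s)
    (ht : ∃ x ∈ K, inner ℝ u x = t) (hK : ∀ x ∈ K, inner ℝ u x ∈ Set.uIcc s t) :
    supp (D K) u = profile D s t := by
  set e : EuclideanSpace ℝ (Fin n) := EuclideanSpace.single 0 1 with he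
  let g : EuclideanSpace ℝ (Fin n) →L[ℝ] EuclideanSpace ℝ (Fin n) :=
    (innerSL ℝ u).smulRight e
  have hg : ∀ x, g x = inner ℝ u x • e := fun x => by simp [g]
  have himg : linImage g K = lineSegment e s t := by
    refine SetLike.coe_injective (Set.Subset.antisymm ?_ ?_)
    · rintro _ ⟨x, hx, rfl⟩
      exact ⟨_, hK x hx, (hg x).symm⟩
    · rintro _ ⟨r, hr, rfl⟩
      have hconv : Convex ℝ ((fun x => inner ℝ u x) '' (K : Set (EuclideanSpace ℝ (Fin n)))) :=
        K.convex.is_linear_image (innerSL ℝ u).toLinearMap.isLinear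
      obtain ⟨x, hx, e'⟩ := (hconv.ordConnected.uIcc_subset hs ht) hr
      refine ⟨x, hx, ?_⟩
      rw [hg, ← e']
  rw [profile, ← he, ← himg, hD.map_linImage hc]
  have hee : inner ℝ e e = (1 : ℝ) := by simp [he]
  obtain ⟨x, hx, h⟩ := exists_inner_eq_supp (D K) u
  refine (supp_eq_of_isGreatest ?_ ?_).symm
  · rintro _ ⟨y, hy, rfl⟩
    rw [hg, real_inner_smul_right, hee, mul_one]
    exact inner_le_supp u hy
  · exact ⟨g x, ⟨x, hx, rfl⟩, by rw [hg, real_inner_smul_right, hee, mul_one, h]⟩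

theorem profile_comm (s t : ℝ) : profile D s t = profile D t s := by
  have : ∀ e : EuclideanSpace ℝ (Fin n), lineSegment e s t = lineSegment e t s := fun e =>
    SetLike.coe_injective (by
      change (fun r : ℝ => r • e) '' Set.uIcc s t = (fun r : ℝ => r • e) '' Set.uIcc t s
      rw [Set.uIcc_comm])
  rw [profile, this, profile]

theorem supp_eq_profile_supp (hD : GLCovariant D) (hc : Continuous D) (K : Kn n)
    (u : EuclideanSpace ℝ (Fin n)) :
    supp (D K) u = profile D (-supp K (-u)) (supp K u) := by
  obtain ⟨x, hx, e⟩ := exists_inner_eq_supp K u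
  obtain ⟨y, hy, e'⟩ := exists_inner_eq_supp K (-u)
  rw [inner_neg_left] at e'
  refine supp_eq_profile hD hc ⟨y, hy, by linarith⟩ ⟨x, hx, e⟩ fun z hz => ?_
  have h := inner_le_supp (-u) hz
  rw [inner_neg_left] at h
  exact Set.mem_uIcc_of_le (by linarith) (inner_le_supp u hz)

theorem profile_smul (hD : GLCovariant D) (hc : Continuous D) {c : ℝ} (h : 0 ≤ c) (s t : ℝ) :
    profile D (c * s) (c * t) = c * profile D s t := by
  set e : EuclideanSpace ℝ (Fin n) := EuclideanSpace.single 0 1 with he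
  have hee : inner ℝ e e = (1 : ℝ) := by simp [he]
  have := supp_smul (D (lineSegment e s t)) h e
  rw [supp_eq_profile hD hc (s := c * s) (t := c * t)] at this
  · exact this
  · exact ⟨s • e, ⟨s, Set.left_mem_uIcc, rfl⟩, by
      rw [real_inner_smul_left, real_inner_smul_right, hee, mul_one]⟩
  · exact ⟨t • e, ⟨t, Set.right_mem_uIcc, rfl⟩, by
      rw [real_inner_smul_left, real_inner_smul_right, hee, mul_one]⟩
  · rintro _ ⟨r, hr, rfl⟩
    rw [real_inner_smul_left, real_inner_smul_right, hee, mul_one]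
    rw [Set.mem_uIcc] at hr ⊢
    rcases hr with hr | hr
    · exact Or.inl ⟨mul_le_mul_of_nonneg_left hr.1 h, mul_le_mul_of_nonneg_left hr.2 h⟩
    · exact Or.inr ⟨mul_le_mul_of_nonneg_left hr.1 h, mul_le_mul_of_nonneg_left hr.2 h⟩

/-- The convex hull of the three reals `x i` is the interval with end points `s` and `t`. -/
def IsHull (x : Fin 3 → ℝ) (s t : ℝ) : Prop :=
  (∃ i, x i = s) ∧ (∃ i, x i = t) ∧ ∀ i, x i ∈ Set.uIcc s t

theorem supp_triangle (hD : GLCovariant D) (hc : Continuous D)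
    {P : Fin 3 → EuclideanSpace ℝ (Fin n)} {u : EuclideanSpace ℝ (Fin n)} {s t : ℝ}
    (h : IsHull (fun i => inner ℝ u (P i)) s t) :
    supp (D (triangle P)) u = profile D s t := by
  have hP : ∀ i, P i ∈ triangle P := fun i => subset_convexHull ℝ _ ⟨i, rfl⟩
  obtain ⟨⟨i, hi⟩, ⟨j, hj⟩, h⟩ := h
  refine supp_eq_profile hD hc ⟨P i, hP i, hi⟩ ⟨P j, hP j, hj⟩ fun x hx => ?_
  have hconv : Convex ℝ ((fun x => inner ℝ u x) ⁻¹' Set.uIcc s t) :=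
    (convex_uIcc s t).is_linear_preimage (innerSL ℝ u).toLinearMap.isLinear
  exact convexHull_min (Set.range_subset_iff.2 fun i => h i :
    Set.range P ⊆ (fun x => inner ℝ u x) ⁻¹' Set.uIcc s t) hconv hx

/-- Subadditivity of the support function of `D T`, for a triangle `T` in the coordinate plane
with vertices `(x i, y i)`. -/
theorem profile_le_of_isHull (hn : 2 ≤ n) (hD : GLCovariant D) (hc : Continuous D)
    {x y : Fin 3 → ℝ} {s t s' t' s'' t'' : ℝ} (hx : IsHull x s t) (hy : IsHull y s' t')
    (hxy : IsHull (x + y) s'' t'') :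
    profile D s'' t'' ≤ profile D s t + profile D s' t' := by
  let e : EuclideanSpace ℝ (Fin n) := EuclideanSpace.single 0 1
  let f : EuclideanSpace ℝ (Fin n) := EuclideanSpace.single ⟨1, by omega⟩ 1
  have hne : (⟨1, by omega⟩ : Fin n) ≠ 0 := by
    intro h
    simpa using congrArg Fin.val h
  have hee : inner ℝ e e = (1 : ℝ) := by simp [e]
  have hff : inner ℝ f f = (1 : ℝ) := by simp [f]
  have hef : inner ℝ e f = (0 : ℝ) := by
    rw [EuclideanSpace.inner_single_left]
    simp [f, hne.symm]
  have hfe : inner ℝ f e = (0 : ℝ) := by rw [real_inner_comm, hef]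
  let P : Fin 3 → EuclideanSpace ℝ (Fin n) := fun i => x i • e + y i • f
  have h1 : supp (D (triangle P)) e = profile D s t := supp_triangle hD hc (by
    simpa only [P, inner_add_right, real_inner_smul_right, hee, hef, mul_one, mul_zero, add_zero]
      using hx)
  have h2 : supp (D (triangle P)) f = profile D s' t' := supp_triangle hD hc (by
    simpa only [P, inner_add_right, real_inner_smul_right, hff, hfe, mul_one, mul_zero, zero_add]
      using hy)
  have h3 : supp (D (triangle P)) (e + f) = profile D s'' t'' := supp_triangle hD hc (by
    simp only [P, inner_add_right, inner_add_left, real_inner_smul_right, hee, hef, hff, hfe,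
      mul_one, mul_zero, zero_add, add_zero]
    exact hxy)
  rw [← h1, ← h2, ← h3]
  exact supp_add_le _ _ _

theorem profile_add_le (hn : 2 ≤ n) (hD : GLCovariant D) (hc : Continuous D) (s t s' t' : ℝ) :
    profile D (s + s') (t + t') ≤ profile D s t + profile D s' t' := by
  have h : ∀ s t : ℝ, IsHull ![s, t, t] s t := fun s t =>
    ⟨⟨0, rfl⟩, ⟨1, rfl⟩, by intro i; fin_cases i <;> simp⟩
  refine profile_le_of_isHull hn hD hc (h s t) (h s' t') ?_
  convert h (s + s') (t + t') using 1
  ext i; fin_cases i <;> rfl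

theorem profile_zero (hD : GLCovariant D) (hc : Continuous D) : profile D 0 0 = 0 := by
  have := profile_smul hD hc le_rfl 0 0
  simpa using this

/-- If `D` does not map points to points then it maps `[-1, 1] e` to a nondegenerate segment. -/
theorem profile_one_one_add_le (hn : 2 ≤ n) (hD : GLCovariant D) (hc : Continuous D) :
    profile D 1 1 + profile D (-1) (-1) ≤ 8 * profile D (-1) 1 := by
  have h1 : profile D 1 1 ≤ profile D (-1) 2 + profile D 2 (-1) := by
    have := profile_add_le hn hD hc (-1) 2 2 (-1)
    norm_num at this
    exact this
  have h2 : profile D (-1) (-1) ≤ profile D (-2) 1 + profile D 1 (-2) := by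
    have := profile_add_le hn hD hc (-2) 1 1 (-2)
    norm_num at this
    exact this
  -- the sum of two coordinates may have an asymmetric range on a triangle, although both
  -- coordinates range over `[-1, 1]`
  have h3 : profile D (-1) 2 ≤ profile D (-1) 1 + profile D (-1) 1 := by
    refine profile_le_of_isHull hn hD hc (x := ![1, -1, 0]) (y := ![1, 0, -1])
      ⟨⟨1, rfl⟩, ⟨0, rfl⟩, ?_⟩ ⟨⟨2, rfl⟩, ⟨0, rfl⟩, ?_⟩ ⟨⟨1, ?_⟩, ⟨0, ?_⟩, ?_⟩
    · intro i; fin_cases i <;> norm_num [Set.mem_uIcc]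
    · intro i; fin_cases i <;> norm_num [Set.mem_uIcc]
    · norm_num
    · norm_num
    · intro i; fin_cases i <;> norm_num [Set.mem_uIcc]
  have h4 : profile D (-2) 1 ≤ profile D (-1) 1 + profile D (-1) 1 := by
    refine profile_le_of_isHull hn hD hc (x := ![-1, 1, 0]) (y := ![-1, 0, 1])
      ⟨⟨0, rfl⟩, ⟨1, rfl⟩, ?_⟩ ⟨⟨0, rfl⟩, ⟨2, rfl⟩, ?_⟩ ⟨⟨0, ?_⟩, ⟨1, ?_⟩, ?_⟩
    · intro i; fin_cases i <;> norm_num [Set.mem_uIcc]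
    · intro i; fin_cases i <;> norm_num [Set.mem_uIcc]
    · norm_num
    · norm_num
    · intro i; fin_cases i <;> norm_num [Set.mem_uIcc]
  rw [profile_comm 2] at h1
  rw [profile_comm 1] at h2
  linarith

/-- If `D` does not map points to points, then `D K` has positive width in every direction `u` for
which the linear form `⟨u, ·⟩` does not vanish on `K`. -/
theorem profile_add_profile_neg_pos (hn : 2 ≤ n) (hD : GLCovariant D) (hc : Continuous D)
    (h : 0 < profile D 1 1 + profile D (-1) (-1)) {s t : ℝ} (hst : s ≠ 0 ∨ t ≠ 0) :
    0 < profile D s t + profile D (-s) (-t) := by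
  have h8 := profile_one_one_add_le hn hD hc
  rcases eq_or_ne s t with rfl | hne
  · have hs : s ≠ 0 := by tauto
    rcases lt_or_gt_of_ne hs with hs | hs
    · have h1 := profile_smul hD hc (neg_nonneg.2 hs.le) 1 1
      have h2 := profile_smul hD hc (neg_nonneg.2 hs.le) (-1) (-1)
      rw [mul_one] at h1
      rw [neg_mul_neg, mul_one] at h2
      nlinarith [mul_pos (neg_pos.2 hs) h]
    · have h1 := profile_smul hD hc hs.le 1 1
      have h2 := profile_smul hD hc hs.le (-1) (-1)
      rw [mul_one] at h1
      rw [mul_neg, mul_one] at h2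
      nlinarith [mul_pos hs h]
  · have h1 := profile_add_le hn hD hc s t (-t) (-s)
    have h2 := profile_add_le hn hD hc (-s) (-t) t s
    rw [profile_comm (-t)] at h1
    rw [profile_comm t s] at h2
    have h3 := profile_smul hD hc (abs_nonneg (t - s)) (-1) 1
    have h4 : profile D (s + -t) (t + -s) = |t - s| * profile D (-1) 1 := by
      rw [← h3]
      rcases abs_cases (t - s) with ⟨e, -⟩ | ⟨e, -⟩
      · rw [e]; congr 1 <;> ring
      · rw [e, profile_comm]; congr 1 <;> ring
    have h5 : profile D (-s + t) (-t + s) = profile D (s + -t) (t + -s) := by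
      rw [profile_comm]; congr 1 <;> ring
    have h6 : 0 < |t - s| * profile D (-1) 1 :=
      mul_pos (abs_pos.2 (sub_ne_zero.2 hne.symm)) (by linarith)
    rw [h5] at h2
    linarith

/-- If `D` maps points to points then it is of the form `K ↦ a K + b (-K)`. -/
theorem exists_eq_smul_add_smul_neg (hn : 2 ≤ n) (hD : GLCovariant D) (hc : Continuous D)
    (h : profile D 1 1 + profile D (-1) (-1) ≤ 0) :
    ∃ a b : ℝ, 0 ≤ a ∧ 0 ≤ b ∧ ∀ K : Kn n, (D K : Set (EuclideanSpace ℝ (Fin n))) =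
      a • (K : Set (EuclideanSpace ℝ (Fin n))) +
        b • (-(K : Set (EuclideanSpace ℝ (Fin n)))) := by
  have h0 := profile_add_le hn hD hc 1 1 (-1) (-1)
  rw [add_neg_cancel, profile_zero hD hc] at h0
  have hα : profile D (-1) (-1) = -profile D 1 1 := by linarith
  have hdiag : ∀ c : ℝ, profile D c c = c * profile D 1 1 := by
    intro c
    rcases le_total 0 c with hc0 | hc0
    · simpa using profile_smul hD hc hc0 1 1
    · have := profile_smul hD hc (neg_nonneg.2 hc0) (-1) (-1)
      rw [hα, neg_mul_neg, mul_one, neg_mul_neg] at this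
      exact this
  have hshift : ∀ s t c : ℝ, profile D (s + c) (t + c) = profile D s t + c * profile D 1 1 := by
    intro s t c
    have h1 := profile_add_le hn hD hc s t c c
    have h2 := profile_add_le hn hD hc (s + c) (t + c) (-c) (-c)
    rw [add_neg_cancel_right, add_neg_cancel_right, hdiag] at h2
    rw [hdiag] at h1
    linarith
  have hlin : ∀ s t : ℝ, s ≤ t →
      profile D s t = t * profile D 0 1 - s * profile D (-1) 0 := by
    intro s t hst
    have h1 := hshift 0 (t - s) s
    have h2 := hshift (-1) 0 1
    have h3 := profile_smul hD hc (sub_nonneg.2 hst) 0 1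
    rw [zero_add, sub_add_cancel] at h1
    rw [neg_add_cancel, zero_add] at h2
    rw [mul_zero, mul_one] at h3
    rw [h1, h3, h2]
    ring
  -- the signs of the coefficients come from the triangles with vertices `0`, `±e`, `±f`
  have ha : profile D 0 1 ≤ profile D 0 1 + profile D 0 1 := by
    refine profile_le_of_isHull hn hD hc (x := ![0, 1, 0]) (y := ![0, 0, 1])
      ⟨⟨0, rfl⟩, ⟨1, rfl⟩, ?_⟩ ⟨⟨0, rfl⟩, ⟨2, rfl⟩, ?_⟩ ⟨⟨0, ?_⟩, ⟨1, ?_⟩, ?_⟩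
    · intro i; fin_cases i <;> norm_num [Set.mem_uIcc]
    · intro i; fin_cases i <;> norm_num [Set.mem_uIcc]
    · norm_num
    · norm_num
    · intro i; fin_cases i <;> norm_num [Set.mem_uIcc]
  have hb : profile D (-1) 0 ≤ profile D (-1) 0 + profile D (-1) 0 := by
    refine profile_le_of_isHull hn hD hc (x := ![0, -1, 0]) (y := ![0, 0, -1])
      ⟨⟨1, rfl⟩, ⟨0, rfl⟩, ?_⟩ ⟨⟨2, rfl⟩, ⟨0, rfl⟩, ?_⟩ ⟨⟨1, ?_⟩, ⟨0, ?_⟩, ?_⟩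
    · intro i; fin_cases i <;> norm_num [Set.mem_uIcc]
    · intro i; fin_cases i <;> norm_num [Set.mem_uIcc]
    · norm_num
    · norm_num
    · intro i; fin_cases i <;> norm_num [Set.mem_uIcc]
  set a := profile D 0 1
  set b := profile D (-1) 0
  have ha0 : 0 ≤ a := by linarith
  have hb0 : 0 ≤ b := by linarith
  refine ⟨a, b, ha0, hb0, fun K => ?_⟩
  have hset : a • (K : Set (EuclideanSpace ℝ (Fin n))) +
      b • (-(K : Set (EuclideanSpace ℝ (Fin n)))) =
        ((a • K + (-b) • K : Kn n) : Set (EuclideanSpace ℝ (Fin n))) := by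
    rw [ConvexBody.coe_add, ConvexBody.coe_smul, ConvexBody.coe_smul, Set.neg_smul_set,
      Set.smul_set_neg]
  rw [hset]
  refine eq_of_supp_eq fun u => ?_
  obtain ⟨x, hx, ex⟩ := exists_inner_eq_supp K u
  obtain ⟨y, hy, ey⟩ := exists_inner_eq_supp K (-u)
  have hle : -supp K (-u) ≤ supp K u := by
    have := inner_le_supp (-u) hx
    rw [inner_neg_left] at this
    linarith
  rw [supp_eq_profile_supp hD hc, hlin _ _ hle]
  refine (supp_eq_of_isGreatest ?_ ?_).symm
  · rintro _ ⟨_, ⟨p, hp, rfl⟩, _, ⟨q, hq, rfl⟩, rfl⟩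
    have h1 := mul_le_mul_of_nonneg_left (inner_le_supp u hp) ha0
    have h2 := mul_le_mul_of_nonneg_left (inner_le_supp (-u) hq) hb0
    rw [inner_neg_left] at h2
    simp only [inner_add_right, real_inner_smul_right]
    linarith
  · refine ⟨a • x + (-b) • y, Set.add_mem_add (Set.smul_mem_smul_set hx)
      (Set.smul_mem_smul_set hy), ?_⟩
    rw [inner_neg_left] at ey
    rw [inner_add_right, real_inner_smul_right, real_inner_smul_right, ex, ← ey]
    ring

end Profile

/-! ### Bodies of lower dimension -/

section ZonotopeMembership

variable {V : Type*} [NormedAddCommGroup V] [NormedSpace ℝ V]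

theorem ConvexBody.sum_mem_sum {ι : Type*} (s : Finset ι) (x : ι → V) (K : ι → ConvexBody V)
    (h : ∀ i ∈ s, x i ∈ K i) : ∑ i ∈ s, x i ∈ ∑ i ∈ s, K i := by
  classical
  induction s using Finset.induction_on with
  | empty => exact rfl
  | insert i s hi ih =>
    rw [Finset.sum_insert hi, Finset.sum_insert hi]
    exact Set.add_mem_add (h i (Finset.mem_insert_self _ _))
      (ih fun j hj => h j (Finset.mem_insert_of_mem hj))

theorem sum_smul_mem_zonotope_ofFn {m : ℕ} (v : Fin m → V) {r : Fin m → ℝ}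
    (hr : ∀ i, |r i| ≤ 1) : ∑ i, r i • v i ∈ zonotope (List.ofFn v) := by
  have e : zonotope (List.ofFn v) = ∑ i, symSeg (v i) := by
    rw [zonotope, List.map_ofFn, List.sum_ofFn]
    rfl
  rw [e]
  exact ConvexBody.sum_mem_sum _ _ _ fun i _ => ⟨r i, abs_le.1 (hr i), rfl⟩

theorem zero_mem_zonotope_ofFn {m : ℕ} (v : Fin m → V) : (0 : V) ∈ zonotope (List.ofFn v) := by
  simpa using sum_smul_mem_zonotope_ofFn v (r := 0) (by simp)

theorem mem_zonotope_ofFn {m : ℕ} (v : Fin m → V) (i : Fin m) :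
    v i ∈ zonotope (List.ofFn v) := by
  have := sum_smul_mem_zonotope_ofFn v (r := Pi.single i 1) fun j => by
    by_cases h : j = i
    · subst h; simp
    · simp [h]
  simpa [Pi.single_apply] using this

/-- Shrinking the `m` segments of a zonotope by a factor `ρ ≤ 1` decreases a nonnegative
segment-affine functional at most by a factor `ρ ^ m`. -/
theorem SegmentAffine.pow_mul_le {φ : ConvexBody V → ℝ} (hφ : SegmentAffine φ)
    (h0 : ∀ K, 0 ≤ φ K) {ρ : ℝ} (hρ : 0 ≤ ρ) (hρ1 : ρ ≤ 1) (vs : List V) (K : ConvexBody V) :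
    ρ ^ vs.length * φ (K + zonotope vs) ≤ φ (K + ρ • zonotope vs) := by
  induction vs generalizing K with
  | nil => simp
  | cons v vs ih =>
    have e : K + ρ • zonotope (v :: vs) = (K + ρ • symSeg v) + ρ • zonotope vs := by
      rw [zonotope_cons, smul_add, add_assoc]
    have e' : K + ρ • symSeg v + zonotope vs = (K + zonotope vs) + ρ • symSeg v :=
      add_right_comm _ _ _
    have e'' : K + zonotope (v :: vs) = K + zonotope vs + symSeg v := by
      rw [zonotope_cons, add_comm (symSeg v), add_assoc]
    have h1 := hφ.affine (K + zonotope vs) v hρ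
    have h2 := ih (K + ρ • symSeg v)
    rw [e', h1] at h2
    rw [e, e'', List.length_cons]
    refine le_trans ?_ h2
    rw [pow_succ, mul_assoc]
    refine mul_le_mul_of_nonneg_left ?_ (pow_nonneg hρ _)
    nlinarith [h0 (K + zonotope vs)]

end ZonotopeMembership

/-- A convex body without volume lies in a hyperplane. -/
theorem ConvexBody.exists_inner_eq_of_measureReal_eq_zero {V : Type*} [NormedAddCommGroup V]
    [InnerProductSpace ℝ V] [FiniteDimensional ℝ V] [MeasurableSpace V] [BorelSpace V]
    (μ : Measure V) [μ.IsAddHaarMeasure] {K : ConvexBody V} (h : μ.real (K : Set V) = 0) :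
    ∃ u : V, u ≠ 0 ∧ ∀ x ∈ K, ∀ y ∈ K, inner ℝ u x = inner ℝ u y := by
  have hint : ¬ (interior (K : Set V)).Nonempty := by
    intro hne
    have h1 := isOpen_interior.measure_pos μ hne
    have h2 : μ (K : Set V) = 0 :=
      (measureReal_eq_zero_iff K.isCompact.measure_lt_top.ne).1 h
    exact h1.ne' (measure_mono_null interior_subset h2)
  rw [K.convex.interior_nonempty_iff_affineSpan_eq_top] at hint
  have hne : (affineSpan ℝ (K : Set V) : Set V).Nonempty := K.nonempty.mono (subset_affineSpan _ _)
  have hdir : (affineSpan ℝ (K : Set V)).direction ≠ ⊤ := fun h' =>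
    hint ((AffineSubspace.direction_eq_top_iff_of_nonempty hne).1 h')
  have hbot : (affineSpan ℝ (K : Set V)).directionᗮ ≠ ⊥ := fun h' =>
    hdir (Submodule.orthogonal_eq_bot_iff.1 h')
  obtain ⟨u, hu, hu0⟩ := Submodule.exists_mem_ne_zero_of_ne_bot hbot
  refine ⟨u, hu0, fun x hx y hy => ?_⟩
  have := (Submodule.mem_orthogonal' _ u).1 hu (x - y)
    (AffineSubspace.vsub_mem_direction (subset_affineSpan ℝ _ hx) (subset_affineSpan ℝ _ hy))
  rwa [inner_sub_right, sub_eq_zero] at this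

section LowerDimensional

variable {n : ℕ}

/-- Let `L` lie in the span of `n - l` vectors. If `W_l(L) = 0` then the sum of `L` and `l`
segments has volume zero: by the Steiner formula the volume of `L + ρ B` is of order `ρ ^ (l + 1)`
as `ρ → 0`, while shrinking the `l` segments costs a factor `ρ ^ l` only. -/
theorem measureReal_add_zonotope_eq_zero {l : ℕ} (hl : l < n) {L : Kn n}
    {vs ws : List (EuclideanSpace ℝ (Fin n))} (hvs : vs.length + l = n) (hws : ws.length = l)
    {R : ℝ} (hR : 0 < R)
    (hL : (L : Set (EuclideanSpace ℝ (Fin n))) ⊆ (R • zonotope vs : Kn n))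
    (h0 : quermassintegral l L = 0) :
    volume.real ((L + zonotope ws : Kn n) : Set (EuclideanSpace ℝ (Fin n))) = 0 := by
  have hvan : ∀ j ≤ l, quermassintegral j L = 0 := by
    intro j hj
    rcases hj.eq_or_lt with rfl | hj
    · exact h0
    · refine le_antisymm ?_ (quermassintegral_nonneg (by omega) L)
      refine ((segmentAffine_quermassintegral (by omega)).mono hL).trans ?_
      rw [quermassintegral_smul (by omega) _ hR,
        quermassintegral_zonotope_eq_zero (by omega), mul_zero]
  set C := ∑ j ∈ Finset.range (n + 1), |(n.choose j : ℝ) * quermassintegral j L| with hC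
  have hsmall : ∀ σ : ℝ, 0 ≤ σ → σ ≤ 1 → parallelVolume L σ ≤ C * σ ^ (l + 1) := by
    intro σ hσ hσ1
    rw [parallelVolume_eq_sum L hσ, hC, Finset.sum_mul]
    refine Finset.sum_le_sum fun j _ => ?_
    rcases le_or_gt j l with hj | hj
    · rw [hvan j hj]; simp
    · rw [mul_comm]
      exact mul_le_mul (le_abs_self _) (pow_le_pow_of_le_one hσ hσ1 hj) (by positivity)
        (abs_nonneg _)
  obtain ⟨r, hr, hball⟩ := (zonotope ws).isBounded.exists_pos_norm_le
  set M := volume.real ((L + zonotope ws : Kn n) : Set (EuclideanSpace ℝ (Fin n))) with hM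
  have hM0 : 0 ≤ M := measureReal_nonneg
  have hmain : ∀ ρ : ℝ, 0 < ρ → ρ ≤ 1 → ρ * r ≤ 1 → M ≤ C * r ^ (l + 1) * ρ := by
    intro ρ hρ hρ1 hρr
    have h1 := (segmentAffine_measureReal
      (volume : Measure (EuclideanSpace ℝ (Fin n)))).pow_mul_le
        (fun _ => measureReal_nonneg) hρ.le hρ1 ws L
    have h2 : volume.real ((L + ρ • zonotope ws : Kn n) : Set (EuclideanSpace ℝ (Fin n))) ≤
        parallelVolume L (ρ * r) := by
      rw [parallelVolume_eq]
      refine measureReal_mono ?_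
        (L + (ρ * r) • ballBody (EuclideanSpace ℝ (Fin n))).isCompact.measure_lt_top.ne
      rw [ConvexBody.coe_add, ConvexBody.coe_add, mul_smul, ConvexBody.coe_smul ρ,
        ConvexBody.coe_smul ρ]
      refine Set.add_subset_add_left (Set.smul_set_mono fun x hx => ?_)
      rw [coe_smul_ballBody hr.le, mem_closedBall_zero_iff]
      exact hball x hx
    have h3 := hsmall (ρ * r) (by positivity) hρr
    rw [hws] at h1
    have h4 : ρ ^ l * M ≤ ρ ^ l * (C * r ^ (l + 1) * ρ) := by
      calc ρ ^ l * M ≤ C * (ρ * r) ^ (l + 1) := h1.trans (h2.trans h3)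
        _ = _ := by rw [mul_pow]; ring
    exact le_of_mul_le_mul_left h4 (by positivity)
  refine le_antisymm ?_ hM0
  have lim : Tendsto (fun ρ : ℝ => C * r ^ (l + 1) * ρ) (𝓝[>] 0) (𝓝 (C * r ^ (l + 1) * 0)) :=
    ((continuous_const.mul continuous_id).tendsto _).mono_left nhdsWithin_le_nhds
  rw [mul_zero] at lim
  refine ge_of_tendsto lim ?_
  filter_upwards [Ioo_mem_nhdsGT (show (0 : ℝ) < min 1 (1 / r) by positivity)] with ρ hρ
  refine hmain ρ hρ.1 (hρ.2.le.trans (min_le_left _ _)) ?_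
  rw [← le_div_iff₀ hr]
  exact hρ.2.le.trans (min_le_right _ _)

end LowerDimensional

/-! ### Operators with a Rogers-Shephard type inequality -/

section Necessity

variable {n : ℕ} [NeZero n] {D : Kn n → Kn n}

/-- A Rogers-Shephard type inequality for `W_l` forces `D` to map points to points. Otherwise `D`
raises the dimension of `e_k + ∑_{i < k} [-e_i, e_i]`, where `k = n - l - 1`, from `k` to `k + 1`,
and `W_l` vanishes on the bodies of dimension `k` but not on those of dimension `k + 1`. -/
theorem profile_one_one_add_nonpos (hn : 2 ≤ n) (hD : GLCovariant D) (hc : Continuous D) {l : ℕ}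
    (hl : l < n) (hRS : RogersShephardType (quermassintegral l) D) :
    profile D 1 1 + profile D (-1) (-1) ≤ 0 := by
  by_contra! hpos
  obtain ⟨C, -, hC⟩ := hRS
  let e : Fin n → EuclideanSpace ℝ (Fin n) := fun i => EuclideanSpace.single i 1
  have he : ∀ (u : EuclideanSpace ℝ (Fin n)) i, inner ℝ u (e i) = u i := fun u i => by
    simp [e, EuclideanSpace.inner_single_right]
  let v : Fin (n - l - 1) → EuclideanSpace ℝ (Fin n) := fun i => e ⟨i, by omega⟩
  let v' : Fin (n - l) → EuclideanSpace ℝ (Fin n) := fun i => e ⟨i, by omega⟩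
  let w : Fin l → EuclideanSpace ℝ (Fin n) := fun i => e ⟨n - l + i, by omega⟩
  let k : Fin n := ⟨n - l - 1, by omega⟩
  let K : Kn n := pointBody (e k) + zonotope (List.ofFn v)
  have hKk : e k ∈ K := Set.mem_add.2 ⟨_, rfl, 0, zero_mem_zonotope_ofFn v, add_zero _⟩
  have hKi : ∀ i, e k + v i ∈ K := fun i => Set.add_mem_add rfl (mem_zonotope_ofFn v i)
  have hWK : quermassintegral l K = 0 := by
    rw [quermassintegral_pointBody_add]
    refine quermassintegral_zonotope_eq_zero ?_
    rw [List.length_ofFn]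
    omega
  have hWL : quermassintegral l (D K) = 0 := by
    refine le_antisymm ?_ (quermassintegral_nonneg hl _)
    simpa [hWK] using hC K
  -- the coordinates of `K`, and hence those of `D K`, with index at least `n - l` vanish
  have hcoordK : ∀ x ∈ K, ∀ i : Fin n, n - l ≤ i → x i = 0 := by
    rintro _ ⟨_, rfl, y, hy, rfl⟩ i hi
    have hk : (e k) i = 0 := by
      have : i ≠ k := by
        rintro rfl
        simp only [k] at hi
        omega
      simp [e, this]
    have hsupp : ∀ u : EuclideanSpace ℝ (Fin n), (∀ j, inner ℝ u (v j) = 0) →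
        zonotopeSupport (List.ofFn v) u = 0 := by
      intro u hu
      rw [zonotopeSupport, List.map_ofFn, List.sum_ofFn]
      simp [hu]
    have hi' : ∀ j, inner ℝ (e i) (v j) = 0 := by
      intro j
      have : (⟨j, by omega⟩ : Fin n) ≠ i := by
        intro h
        have h' : (j : ℕ) = i := congrArg Fin.val h
        omega
      simp only [v, he]
      simp [e, this]
    have h1 := inner_le_zonotopeSupport (e i) hy
    have h2 := inner_le_zonotopeSupport (-e i) hy
    rw [hsupp _ hi', real_inner_comm, he] at h1
    rw [hsupp _ (fun j => by rw [inner_neg_left, hi', neg_zero]), inner_neg_left,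
      real_inner_comm, he] at h2
    change (e k) i + y i = 0
    linarith
  have hcoordL : ∀ x ∈ D K, ∀ i : Fin n, n - l ≤ i → x i = 0 := by
    intro x hx i hi
    have key : ∀ c : ℝ, supp (D K) (c • e i) = 0 := by
      intro c
      have hz : ∀ y ∈ K, inner ℝ (c • e i) y = 0 := fun y hy => by
        rw [real_inner_smul_left, real_inner_comm, he, hcoordK y hy i hi, mul_zero]
      rw [supp_eq_profile hD hc (s := 0) (t := 0) ⟨_, hKk, hz _ hKk⟩ ⟨_, hKk, hz _ hKk⟩
        (fun y hy => by rw [hz y hy]; exact Set.left_mem_uIcc), profile_zero hD hc]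
    have h1 := inner_le_supp ((1 : ℝ) • e i) hx
    have h2 := inner_le_supp ((-1 : ℝ) • e i) hx
    rw [key, real_inner_smul_left, real_inner_comm, he] at h1 h2
    linarith
  obtain ⟨R, hR, hbound⟩ := (D K).isBounded.exists_pos_norm_le
  have hLsub : (D K : Set (EuclideanSpace ℝ (Fin n))) ⊆ (R • zonotope (List.ofFn v') : Kn n) := by
    intro x hx
    refine Set.mem_smul_set.2 ⟨∑ i : Fin (n - l), (R⁻¹ * x ⟨i, by omega⟩) • v' i,
      sum_smul_mem_zonotope_ofFn v' fun i => ?_, ?_⟩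
    · rw [abs_mul, abs_of_pos (inv_pos.2 hR), inv_mul_le_iff₀ hR, mul_one]
      exact (PiLp.norm_apply_le x _).trans (hbound x hx)
    · ext j
      simp only [Finset.smul_sum, smul_smul, mul_inv_cancel_left₀ hR.ne']
      rw [WithLp.ofLp_sum, Finset.sum_apply]
      simp only [v', e, PiLp.smul_apply, PiLp.single_apply, smul_eq_mul, mul_ite,
        mul_one, mul_zero]
      by_cases hj : (j : ℕ) < n - l
      · rw [Finset.sum_eq_single ⟨j, hj⟩]
        · simp
        · intro i _ hi
          rw [if_neg]
          rintro rfl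
          exact hi rfl
        · simp
      · rw [hcoordL x hx j (by omega)]
        refine Finset.sum_eq_zero fun i _ => if_neg ?_
        rintro rfl
        exact hj i.2
  have hzero := measureReal_add_zonotope_eq_zero hl (vs := List.ofFn v') (ws := List.ofFn w)
    (by rw [List.length_ofFn]; omega) List.length_ofFn hR hLsub hWL
  obtain ⟨u, hu0, hu⟩ := ConvexBody.exists_inner_eq_of_measureReal_eq_zero _ hzero
  have huw : ∀ i, inner ℝ u (w i) = 0 := by
    intro i
    obtain ⟨x, hx⟩ := (D K).nonempty
    have := hu (x + w i) (Set.add_mem_add hx (mem_zonotope_ofFn w i)) (x + 0)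
      (Set.add_mem_add hx (zero_mem_zonotope_ofFn w))
    rw [inner_add_right, inner_add_right, inner_zero_right] at this
    linarith
  -- the width of `D K` in direction `u` vanishes, so that `⟨u, ·⟩` vanishes on `K`
  have hwidth : supp (D K) u + supp (D K) (-u) = 0 := by
    obtain ⟨x, hx, ex⟩ := exists_inner_eq_supp (D K) u
    obtain ⟨y, hy, ey⟩ := exists_inner_eq_supp (D K) (-u)
    have := hu (x + 0) (Set.add_mem_add hx (zero_mem_zonotope_ofFn w)) (y + 0)
      (Set.add_mem_add hy (zero_mem_zonotope_ofFn w))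
    rw [inner_neg_left] at ey
    rw [add_zero, add_zero] at this
    linarith
  rw [supp_eq_profile_supp hD hc K u, supp_eq_profile_supp hD hc K (-u), neg_neg,
    profile_comm (-supp K u)] at hwidth
  have hst : -supp K (-u) = 0 ∧ supp K u = 0 := by
    by_contra hne
    have := profile_add_profile_neg_pos hn hD hc hpos
      (s := -supp K (-u)) (t := supp K u) (by tauto)
    rw [neg_neg] at this
    linarith
  have huK : ∀ x ∈ K, inner ℝ u x = 0 := by
    intro x hx
    have h1 := inner_le_supp u hx
    have h2 := inner_le_supp (-u) hx
    rw [inner_neg_left] at h2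
    linarith [hst.1, hst.2]
  refine hu0 ?_
  ext j
  change u j = 0
  have hk0 := huK _ hKk
  rcases lt_trichotomy (j : ℕ) (n - l - 1) with hj | hj | hj
  · have := huK _ (hKi ⟨j, hj⟩)
    rw [inner_add_right, hk0, zero_add, he] at this
    exact this
  · have hjk : j = k := Fin.ext hj
    rwa [he, ← hjk] at hk0
  · have := huw ⟨j - (n - l), by omega⟩
    rw [he] at this
    convert this using 2
    ext
    simp only
    omega

end Necessity

theorem theorem4p3 (n : ℕ) (hn : 2 ≤ n) (D : Kn n → Kn n) :
    ((Continuous D ∧ GLCovariant D ∧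
        ∃ l : ℕ, l < n ∧ RogersShephardType (quermassintegral l) D) ↔
      ∃ a b : ℝ, 0 ≤ a ∧ 0 ≤ b ∧ ∀ K : Kn n,
        (D K : Set (EuclideanSpace ℝ (Fin n))) =
          a • (K : Set (EuclideanSpace ℝ (Fin n))) +
            b • (-(K : Set (EuclideanSpace ℝ (Fin n))))) ∧
    ((∃ a b : ℝ, 0 ≤ a ∧ 0 ≤ b ∧ ∀ K : Kn n,
        (D K : Set (EuclideanSpace ℝ (Fin n))) =
          a • (K : Set (EuclideanSpace ℝ (Fin n))) +
            b • (-(K : Set (EuclideanSpace ℝ (Fin n))))) →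
      ∀ l : ℕ, l < n → RogersShephardType (quermassintegral l) D) := by
  have : NeZero n := ⟨by omega⟩
  refine ⟨⟨?_, ?_⟩, ?_⟩
  · rintro ⟨hc, hD, l, hl, hRS⟩
    exact exists_eq_smul_add_smul_neg hn hD hc (profile_one_one_add_nonpos hn hD hc hl hRS)
  · rintro ⟨a, b, ha, hb, h⟩
    exact ⟨continuous_of_eq_smul_add_smul_neg ha hb h, glCovariant_of_eq_smul_add_smul_neg h,
      0, by omega, rogersShephardType_of_eq_smul_add_smul_neg ha hb h (by omega)⟩
  · rintro ⟨a, b, ha, hb, h⟩ l hl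
    exact rogersShephardType_of_eq_smul_add_smul_neg ha hb h hl
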